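/- Let $M$ be a smooth manifold of dimension $n\ge 0$, let $q\in\{0,1,2,n-1,n\}$ with $q\ge 0$, and let $\zeta$ be a smooth differential $q$-form on $M$. Suppose that $\zeta$ is closed, $d\zeta=0$, and algebraically constant, that is, for any two points $x,y\in M$ there is a linear isomorphism $T_xM\to T_yM$ sending $\zeta_x$ to $\zeta_y$. Then $\zeta$ is locally constant: around every point of $M$ there are smooth local coordinates $x^1,\dots,x^n$ in which all the components $\zeta(\partial_{i_1},\dots,\partial_{i_q})$ of $\zeta$ are constant functions. -/

import Mathlib

open scoped Manifold ContDiff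

/-- A (not necessarily smooth) field of alternating `q`-linear forms on the tangent spaces of a
manifold `M` modelled on `ℝⁿ`. Linear forms on the finite-dimensional tangent spaces are
automatically continuous. -/
abbrev FormField (n q : ℕ) (M : Type*) [TopologicalSpace M]
    [ChartedSpace (EuclideanSpace ℝ (Fin n)) M] :=
  ∀ x : M, (TangentSpace (𝓡 n) x) [⋀^Fin q]→L[ℝ] ℝ

namespace FormField

variable {n q : ℕ} {M : Type*} [TopologicalSpace M] [ChartedSpace (EuclideanSpace ℝ (Fin n)) M]

/-- The expression of `ζ` in local coordinates `φ`: the pullback of `ζ` under the inverse of `φ`,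
a form on the open set `φ.target ⊆ ℝⁿ`. It is meaningful only at points of `φ.target`. -/
noncomputable def inCoordinates (ζ : FormField n q M)
    (φ : OpenPartialHomeomorph M (EuclideanSpace ℝ (Fin n))) (y : EuclideanSpace ℝ (Fin n)) :
    (EuclideanSpace ℝ (Fin n)) [⋀^Fin q]→L[ℝ] ℝ :=
  (ζ (φ.symm y)).compContinuousLinearMap (mfderiv (𝓡 n) (𝓡 n) φ.symm y)

/-- The component `ζ_{i₁ … i_q} = ζ(∂_{i₁}, …, ∂_{i_q})` of `ζ` in the local coordinates `φ`,
at the point with coordinates `y`. -/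
noncomputable def component (ζ : FormField n q M)
    (φ : OpenPartialHomeomorph M (EuclideanSpace ℝ (Fin n))) (i : Fin q → Fin n)
    (y : EuclideanSpace ℝ (Fin n)) : ℝ :=
  ζ.inCoordinates φ y (fun k => EuclideanSpace.single (i k) 1)

/-- `ζ` is smooth, that is, a differential `q`-form: its expression in every chart of the smooth
structure is smooth. -/
def IsSmooth (ζ : FormField n q M) : Prop :=
  ∀ φ ∈ IsManifold.maximalAtlas (𝓡 n) ∞ M, ContDiffOn ℝ ∞ (ζ.inCoordinates φ) φ.target

/-- `dζ = 0`, where the exterior derivative is computed in charts of the smooth structure. -/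
def IsClosed (ζ : FormField n q M) : Prop :=
  ∀ φ ∈ IsManifold.maximalAtlas (𝓡 n) ∞ M, ∀ y ∈ φ.target, extDeriv (ζ.inCoordinates φ) y = 0

/-- For any points `x` and `y`, some linear isomorphism `T_x M → T_y M` sends `ζ_x` to `ζ_y`. -/
def IsAlgebraicallyConstant (ζ : FormField n q M) : Prop :=
  ∀ x y : M, ∃ L : TangentSpace (𝓡 n) x ≃L[ℝ] TangentSpace (𝓡 n) y,
    (ζ x).compContinuousLinearMap
      (L.symm : TangentSpace (𝓡 n) y →L[ℝ] TangentSpace (𝓡 n) x) = ζ y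

/-- Around every point there are local coordinates, belonging to the smooth structure, in which
all components of `ζ` are constant. -/
def IsLocallyConstant (ζ : FormField n q M) : Prop :=
  ∀ x : M, ∃ φ ∈ IsManifold.maximalAtlas (𝓡 n) ∞ M, x ∈ φ.source ∧
    ∀ i : Fin q → Fin n, ∃ c : ℝ, ∀ y ∈ φ.target, ζ.component φ i y = c

end FormField

open Filter Topology

/-! In a chart, `ζ` becomes a closed form `α` near a point `x` of `ℝⁿ`, and algebraic constancy says
that each nearby `α z` is `α x` composed with a linear automorphism. It suffices to show that `α` is
`Rectifiable`: near `x` it is the pullback of a constant form under a local diffeomorphism, which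
then serves as a change of coordinates. If `α x = 0`, or the degree is `0`, then `α` is already
constant near `x`. Otherwise algebraic constancy is used through two consequences: `α` does not
vanish, and its rank, the codimension of its kernel `{v | α(v, ·) = 0}`, is constant.

The main tool is reduction of dimension (`Rectifiable.of_reduction`). By constant rank, a kernel
vector at `x` extends to a smooth vector field `X` annihilating `α`. In coordinates where `X` is a
constant field `v`, closedness forces `D_v α = 0`, so `α` is pulled back from a hyperplane
transverse to `v`.

A closed 1-form is `du`, and `u` is a submersion if `α x ≠ 0`. A nonvanishing top form is rectified
by changing a single coordinate, with no induction. A form of codegree one always has a kernel, so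
one reduction turns it into a top form. A 2-form is treated by induction on dimension (Darboux): if
it is nondegenerate, subtracting `du ∧ b`, with `b` a constant covector and `u` a time function of
its Hamiltonian field, leaves a closed form of constant rank with nonzero kernel; its rectification
is then corrected along the kernel so as to rectify `du ∧ b` too.

Straightening rests on smooth dependence of flows on initial data, obtained from the inverse
function theorem in the Banach space of continuous curves on `[0, 1]`.

All statements concern germs. Smoothness is required on a neighbourhood because `ContDiffAt ℝ ∞` at
one point only gives a neighbourhood for each finite order. -/

/-- `f` is smooth in a neighbourhood of `x`. -/
def SmoothNear {E F : Type*} [NormedAddCommGroup E] [NormedSpace ℝ E] [NormedAddCommGroup F]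
    [NormedSpace ℝ F] (f : E → F) (x : E) : Prop :=
  ∀ᶠ z in 𝓝 x, ContDiffAt ℝ ∞ f z

/-! ### Calculus of smooth germs and the inverse function theorem. -/

namespace SmoothNear

variable {E F G : Type*} [NormedAddCommGroup E] [NormedSpace ℝ E] [NormedAddCommGroup F]
  [NormedSpace ℝ F] [NormedAddCommGroup G] [NormedSpace ℝ G] {f g : E → F} {x : E}

theorem contDiffAt (hf : SmoothNear f x) : ContDiffAt ℝ ∞ f x := hf.self_of_nhds

theorem continuousAt (hf : SmoothNear f x) : ContinuousAt f x := hf.contDiffAt.continuousAt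

theorem differentiableAt (hf : SmoothNear f x) : DifferentiableAt ℝ f x :=
  hf.contDiffAt.differentiableAt (by simp)

theorem eventually_smoothNear (hf : SmoothNear f x) : ∀ᶠ z in 𝓝 x, SmoothNear f z :=
  eventually_eventually_nhds.2 hf

theorem eventually_differentiableAt (hf : SmoothNear f x) :
    ∀ᶠ z in 𝓝 x, DifferentiableAt ℝ f z :=
  hf.mono fun _ h => h.differentiableAt (by simp)

theorem of_contDiff (hf : ContDiff ℝ ∞ f) : SmoothNear f x :=
  Eventually.of_forall fun _ => hf.contDiffAt

theorem congr (hf : SmoothNear f x) (h : g =ᶠ[𝓝 x] f) : SmoothNear g x := by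
  filter_upwards [hf, eventually_eventually_nhds.2 h] with z hz hz'
  exact hz.congr_of_eventuallyEq hz'

theorem comp {h : F → G} (hh : SmoothNear h (f x)) (hf : SmoothNear f x) :
    SmoothNear (fun z => h (f z)) x := by
  filter_upwards [hf, hf.continuousAt.eventually hh] with z hz hz'
  exact hz'.comp z hz

theorem contDiff_comp {h : F → G} (hh : ContDiff ℝ ∞ h) (hf : SmoothNear f x) :
    SmoothNear (fun z => h (f z)) x :=
  (of_contDiff hh).comp hf

theorem fderiv (hf : SmoothNear f x) : SmoothNear (fderiv ℝ f) x := by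
  filter_upwards [hf] with z hz
  exact hz.fderiv_right (by simp)

theorem prodMk {h : E → G} (hf : SmoothNear f x) (hh : SmoothNear h x) :
    SmoothNear (fun z => (f z, h z)) x := by
  filter_upwards [hf, hh] with z h1 h2
  exact h1.prodMk h2

theorem add (hf : SmoothNear f x) (hg : SmoothNear g x) : SmoothNear (fun z => f z + g z) x := by
  filter_upwards [hf, hg] with z h1 h2
  exact h1.add h2

theorem sub (hf : SmoothNear f x) (hg : SmoothNear g x) : SmoothNear (fun z => f z - g z) x := by
  filter_upwards [hf, hg] with z h1 h2
  exact h1.sub h2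

theorem smul {a : E → ℝ} (ha : SmoothNear a x) (hg : SmoothNear g x) :
    SmoothNear (fun z => a z • g z) x := by
  filter_upwards [ha, hg] with z h1 h2
  exact h1.smul h2

theorem clm_apply {A : E → F →L[ℝ] G} (hA : SmoothNear A x) (hf : SmoothNear f x) :
    SmoothNear (fun z => A z (f z)) x := by
  filter_upwards [hA, hf] with z h1 h2
  exact h1.clm_apply h2

theorem clm_comp {A : E → F →L[ℝ] G} {H : Type*} [NormedAddCommGroup H] [NormedSpace ℝ H]
    {B : E → H →L[ℝ] F} (hA : SmoothNear A x) (hB : SmoothNear B x) :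
    SmoothNear (fun z => (A z).comp (B z)) x := by
  filter_upwards [hA, hB] with z h1 h2
  exact h1.clm_comp h2

theorem inverse [CompleteSpace F] {A : E → F →L[ℝ] G} (hA : SmoothNear A x) (L : F ≃L[ℝ] G)
    (hL : A x = L) : SmoothNear (fun z => (A z).inverse) x := by
  have : ∀ᶠ z in 𝓝 x, A z ∈ Set.range ((↑) : (F ≃L[ℝ] G) → F →L[ℝ] G) :=
    hA.continuousAt (by rw [hL]; exact L.nhds)
  filter_upwards [hA, this] with z h1 ⟨e, he⟩
  have := contDiffAt_map_inverse (𝕜 := ℝ) (n := ∞) e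
  rw [he] at this
  exact this.comp z h1

end SmoothNear

/-- The inverse function theorem for maps smooth near a point. -/
theorem SmoothNear.exists_openPartialHomeomorph {E F : Type*} [NormedAddCommGroup E]
    [NormedSpace ℝ E] [NormedAddCommGroup F] [NormedSpace ℝ F] [CompleteSpace E]
    {f : E → F} {x : E} (hf : SmoothNear f x) (L : E ≃L[ℝ] F)
    (hL : HasFDerivAt f (L : E →L[ℝ] F) x) :
    ∃ e : OpenPartialHomeomorph E F, x ∈ e.source ∧ (∀ z, e z = f z) ∧
      (∀ z ∈ e.source, ContDiffAt ℝ ∞ f z) ∧ (∀ w ∈ e.target, ContDiffAt ℝ ∞ e.symm w) := by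
  have hrange : ∀ᶠ z in 𝓝 x, _root_.fderiv ℝ f z ∈ Set.range ((↑) : (E ≃L[ℝ] F) → E →L[ℝ] F) :=
    hf.fderiv.continuousAt (by rw [hL.fderiv]; exact L.nhds)
  -- On `U` the derivative stays invertible, so after restriction to `U` the inverse is smooth on
  -- the whole target.
  obtain ⟨U, hU, hUo, hxU⟩ := eventually_nhds_iff.1 (hf.and hrange)
  let e₀ := hf.contDiffAt.toOpenPartialHomeomorph f hL (by simp)
  refine ⟨e₀.restrOpen U hUo, ?_, ?_, ?_, ?_⟩
  · exact ⟨hf.contDiffAt.mem_toOpenPartialHomeomorph_source hL (by simp), hxU⟩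
  · intro z; rfl
  · intro z hz
    exact (hU z hz.2).1
  · intro w hw
    have hm := (e₀.restrOpen U hUo).map_target hw
    obtain ⟨h1, e', he'⟩ := hU _ hm.2
    refine OpenPartialHomeomorph.contDiffAt_symm _ hw (f₀' := e') ?_ h1
    rw [he']
    exact (h1.differentiableAt (by simp)).hasFDerivAt

/-! ### Smoothness of composition operators on continuous functions. -/

section Nemytskii

universe u

variable {K : Type*} [TopologicalSpace K] [CompactSpace K] {E : Type u} [NormedAddCommGroup E]
  [NormedSpace ℝ E]

/-- Pointwise evaluation of a continuous family of continuous linear maps on a continuous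
function, as a continuous linear map into operators. -/
noncomputable def ContinuousMap.applyCLM (K : Type*) [TopologicalSpace K] [CompactSpace K]
    (E F : Type*) [NormedAddCommGroup E] [NormedSpace ℝ E] [NormedAddCommGroup F]
    [NormedSpace ℝ F] : C(K, E →L[ℝ] F) →L[ℝ] C(K, E) →L[ℝ] C(K, F) :=
  LinearMap.mkContinuous₂
    (LinearMap.mk₂ ℝ
      (fun (A : C(K, E →L[ℝ] F)) (γ : C(K, E)) => (⟨fun s => A s (γ s), by fun_prop⟩ : C(K, F)))
      (fun _ _ _ => by ext; simp) (fun _ _ _ => by ext; simp)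
      (fun _ _ _ => by ext; simp) (fun _ _ _ => by ext; simp)) 1
    (fun A γ => by
      rw [one_mul, ContinuousMap.norm_le _ (by positivity)]
      intro s
      exact (ContinuousLinearMap.le_opNorm _ _).trans
        (mul_le_mul (A.norm_coe_le_norm s) (γ.norm_coe_le_norm s) (by positivity)
          (by positivity)))

/-- Mean value inequality on the segment from `γ s` to `η s`. Postcomposition with `fderiv ℝ X` is
continuous in the sup norm, so the derivative varies there by at most `ε`, uniformly in `s`. -/
theorem ContinuousMap.hasFDerivAt_comp_left {F : Type*} [NormedAddCommGroup F] [NormedSpace ℝ F]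
    {X : E → F} (hX : ContDiff ℝ 1 X) (γ : C(K, E)) :
    HasFDerivAt (fun γ : C(K, E) => (⟨X, hX.continuous⟩ : C(E, F)).comp γ)
      (ContinuousMap.applyCLM K E F
        ((⟨fderiv ℝ X, hX.continuous_fderiv (by simp)⟩ : C(E, E →L[ℝ] F)).comp γ)) γ := by
  rw [hasFDerivAt_iff_isLittleO, Asymptotics.isLittleO_iff]
  intro ε hε
  have hc := ContinuousMap.continuous_postcomp (X := K)
    (⟨fderiv ℝ X, hX.continuous_fderiv (by simp)⟩ : C(E, E →L[ℝ] F))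
  obtain ⟨δ, hδ, h⟩ := (Metric.continuous_iff (α := C(K, E)) (β := C(K, E →L[ℝ] F))).1 hc γ ε hε
  filter_upwards [Metric.ball_mem_nhds γ hδ] with η hη
  rw [ContinuousMap.norm_le _ (by positivity)]
  intro s
  have key : ∀ w ∈ segment ℝ (γ s) (η s), ‖fderiv ℝ X w - fderiv ℝ X (γ s)‖ ≤ ε := by
    rintro w ⟨a, b, ha, hb, hab, rfl⟩
    obtain rfl : a = 1 - b := by linarith
    have hθ : dist ((1 - b) • γ + b • η) γ < δ := by
      have e1 : (1 - b) • γ + b • η - γ = b • (η - γ) := by module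
      rw [dist_eq_norm, e1, norm_smul, Real.norm_of_nonneg hb]
      rw [Metric.mem_ball, dist_eq_norm] at hη
      exact (mul_le_of_le_one_left (norm_nonneg _) (by linarith)).trans_lt hη
    have h3 := h _ hθ
    rw [← dist_eq_norm]
    exact (ContinuousMap.dist_apply_le_dist s).trans h3.le
  have := (convex_segment (γ s) (η s)).norm_image_sub_le_of_norm_hasFDerivWithin_le'
    (f := X) (f' := fderiv ℝ X) (φ := fderiv ℝ X (γ s))
    (fun w _ => ((hX.differentiable (by simp)) w).hasFDerivAt.hasFDerivWithinAt)
    key (left_mem_segment ℝ _ _) (right_mem_segment ℝ _ _)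
  refine this.trans ?_
  gcongr
  exact (η - γ).norm_coe_le_norm s

/-- The derivative is again a composition operator, with `fderiv ℝ X`, followed by a bounded linear
map; this allows induction. The induction replaces `F` by `E →L[ℝ] F`, hence the common universe and
the quantifier over `F` inside. -/
theorem ContinuousMap.contDiff_comp_left_nat (n : ℕ) : ∀ {F : Type u} [NormedAddCommGroup F]
    [NormedSpace ℝ F] {X : E → F} (hX : ContDiff ℝ n X),
    ContDiff ℝ n (fun γ : C(K, E) => (⟨X, hX.continuous⟩ : C(E, F)).comp γ) := by
  induction n with
  | zero =>
    intro F _ _ X hX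
    exact contDiff_zero.2 (ContinuousMap.continuous_postcomp _)
  | succ n ih =>
    intro F _ _ X hX
    have h1 : ContDiff ℝ 1 X := hX.of_le (by norm_cast; omega)
    have h2 : ContDiff ℝ n (fderiv ℝ X) := hX.fderiv_right (by norm_cast)
    refine (contDiff_succ_iff_hasFDerivAt (n := n)).2 ⟨_, ?_, fun γ => hasFDerivAt_comp_left h1 γ⟩
    exact (ContinuousMap.applyCLM K E F).contDiff.comp (ih h2)

theorem ContinuousMap.contDiff_comp_left {F : Type u} [NormedAddCommGroup F]
    [NormedSpace ℝ F] {X : E → F} (hX : ContDiff ℝ ∞ X) :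
    ContDiff ℝ ∞ (fun γ : C(K, E) => (⟨X, hX.continuous⟩ : C(E, F)).comp γ) :=
  contDiff_infty.2 fun n => contDiff_comp_left_nat n (contDiff_infty.1 hX n)

end Nemytskii

/-! ### Local flows of smooth vector fields. -/

section Volterra

variable {E : Type*} [NormedAddCommGroup E] [NormedSpace ℝ E]

/-- The operator `γ ↦ (s ↦ ∫₀ˢ γ)` on continuous functions on the unit interval. -/
noncomputable def volterra (E : Type*) [NormedAddCommGroup E] [NormedSpace ℝ E] :
    C(Set.Icc (0 : ℝ) 1, E) →L[ℝ] C(Set.Icc (0 : ℝ) 1, E) :=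
  LinearMap.mkContinuous
    { toFun := fun γ => ⟨fun s => ∫ r in (0 : ℝ)..s, γ (Set.projIcc 0 1 zero_le_one r),
        (intervalIntegral.continuous_primitive
          (fun a b => Continuous.intervalIntegrable (by fun_prop) a b) 0).comp
          continuous_subtype_val⟩
      map_add' := fun γ η => by
        ext s
        exact intervalIntegral.integral_add (Continuous.intervalIntegrable (by fun_prop) _ _)
          (Continuous.intervalIntegrable (by fun_prop) _ _)
      map_smul' := fun c γ => by
        ext s
        exact intervalIntegral.integral_smul _ _ } 1
    (fun γ => by
      rw [one_mul, ContinuousMap.norm_le _ (by positivity)]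
      intro s
      have := intervalIntegral.norm_integral_le_of_norm_le_const (a := 0) (b := (s : ℝ))
        (f := fun r => γ (Set.projIcc 0 1 zero_le_one r)) (C := ‖γ‖)
        (fun r _ => γ.norm_coe_le_norm _)
      refine this.trans (mul_le_of_le_one_right (norm_nonneg _) ?_)
      rw [sub_zero, abs_of_nonneg s.2.1]
      exact s.2.2)

/-- The curve `r ↦ γ (s r)`. -/
noncomputable def rescale (s : Set.Icc (0 : ℝ) 1) (γ : C(Set.Icc (0 : ℝ) 1, E)) :
    C(Set.Icc (0 : ℝ) 1, E) :=
  ⟨fun r => γ (s * r), by fun_prop⟩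

/-- Linear substitution in the integral. It makes the integral equation of time `τ`, rescaled by
`s`, the equation of time `s τ`. -/
theorem volterra_rescale (s : Set.Icc (0 : ℝ) 1) (γ : C(Set.Icc (0 : ℝ) 1, E)) :
    (s : ℝ) • volterra E (rescale s γ) = rescale s (volterra E γ) := by
  ext r
  have h : ∀ u ∈ Set.uIcc (0 : ℝ) r, rescale s γ (Set.projIcc 0 1 zero_le_one u) =
      γ (Set.projIcc 0 1 zero_le_one (s * u)) := by
    intro u hu
    rw [Set.uIcc_of_le r.2.1] at hu
    have hu' : u ∈ Set.Icc (0 : ℝ) 1 := ⟨hu.1, hu.2.trans r.2.2⟩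
    have hsu : (s : ℝ) * u ∈ Set.Icc (0 : ℝ) 1 := (s * ⟨u, hu'⟩ : Set.Icc (0 : ℝ) 1).2
    rw [Set.projIcc_of_mem _ hu', Set.projIcc_of_mem _ hsu]
    rfl
  change (s : ℝ) • (∫ u in (0 : ℝ)..r, rescale s γ (Set.projIcc 0 1 zero_le_one u)) =
    ∫ u in (0 : ℝ)..(s * r), γ (Set.projIcc 0 1 zero_le_one u)
  rw [intervalIntegral.integral_congr h]
  have := intervalIntegral.smul_integral_comp_mul_left (a := 0) (b := (r : ℝ))
    (fun u => γ (Set.projIcc 0 1 zero_le_one u)) (s : ℝ)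
  rw [mul_zero] at this
  exact this

end Volterra

/-- Multiplication by a bump function. Composition operators on all continuous curves require a
globally smooth map. -/
theorem SmoothNear.exists_contDiff_eventuallyEq {E F : Type*} [NormedAddCommGroup E]
    [NormedSpace ℝ E] [FiniteDimensional ℝ E] [NormedAddCommGroup F] [NormedSpace ℝ F]
    {X : E → F} {x : E} (hX : SmoothNear X x) :
    ∃ Y : E → F, ContDiff ℝ ∞ Y ∧ Y =ᶠ[𝓝 x] X := by
  obtain ⟨r, hr, h⟩ := Metric.eventually_nhds_iff_ball.1 hX
  let f : ContDiffBump x := ⟨r / 4, r / 2, by linarith, by linarith⟩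
  refine ⟨fun z => f z • X z, ?_, ?_⟩
  · rw [contDiff_iff_contDiffAt]
    intro z
    by_cases hz : z ∈ Metric.ball x r
    · exact f.contDiffAt.smul (h z hz)
    · have hz' : z ∉ tsupport f := by
        rw [f.tsupport_eq]
        intro hz'
        exact hz (Metric.closedBall_subset_ball (by change r / 2 < r; linarith) hz')
      have : (fun z => f z • X z) =ᶠ[𝓝 z] fun _ => 0 := by
        filter_upwards [notMem_tsupport_iff_eventuallyEq.1 hz'] with w hw
        simp [hw]
      exact contDiffAt_const.congr_of_eventuallyEq this
  · filter_upwards [f.eventuallyEq_one] with z hz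
    simp [hz]

/-- Divide by the time coordinate where it is nonzero and pass to the limit at time `0`. -/
theorem eq_zero_of_eventually_smul_eq_zero {E F : Type*} [NormedAddCommGroup E] [NormedSpace ℝ E]
    [NormedAddCommGroup F] [NormedSpace ℝ F] {g : ℝ × E → F} {p : ℝ × E} (hg : ContinuousAt g p)
    (h : ∀ᶠ p' in 𝓝 p, p'.1 • g p' = 0) : g p = 0 := by
  by_cases hp : p.1 = 0
  · have hc : Tendsto (fun t : ℝ => ((t, p.2) : ℝ × E)) (𝓝[≠] 0) (𝓝 p) := by
      have : Continuous fun t : ℝ => ((t, p.2) : ℝ × E) := by fun_prop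
      have h2 := (this.tendsto 0).mono_left (nhdsWithin_le_nhds (s := {0}ᶜ))
      rwa [show ((0 : ℝ), p.2) = p from Prod.ext hp.symm rfl] at h2
    refine tendsto_nhds_unique (hg.tendsto.comp hc) ?_
    refine tendsto_const_nhds.congr' ?_
    filter_upwards [hc.eventually h, self_mem_nhdsWithin] with t ht ht0
    exact ((smul_eq_zero.1 ht).resolve_left ht0).symm
  · exact (smul_eq_zero.1 h.self_of_nhds).resolve_left hp

theorem rescale_comp {E F : Type*} [NormedAddCommGroup E] [NormedAddCommGroup F]
    [NormedSpace ℝ E] [NormedSpace ℝ F] (s : Set.Icc (0 : ℝ) 1) (X : C(E, F))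
    (γ : C(Set.Icc (0 : ℝ) 1, E)) : X.comp (rescale s γ) = rescale s (X.comp γ) := rfl

/-- A vector field that is smooth near a point has a smooth local flow. -/
theorem SmoothNear.exists_flow {E : Type*} [NormedAddCommGroup E] [NormedSpace ℝ E]
    [FiniteDimensional ℝ E] {X : E → E} {x : E} (hX : SmoothNear X x) :
    ∃ Φ : ℝ × E → E, SmoothNear Φ (0, x) ∧ (∀ᶠ y in 𝓝 x, Φ (0, y) = y) ∧
      ∀ᶠ p in 𝓝 ((0 : ℝ), x), _root_.fderiv ℝ Φ p (1, 0) = X (Φ p) := by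
  obtain ⟨Y, hY, hYX⟩ := hX.exists_contDiff_eventuallyEq
  have : CompleteSpace E := FiniteDimensional.complete ℝ E
  let Yc : C(E, E) := ⟨Y, hY.continuous⟩
  let B := C(Set.Icc (0 : ℝ) 1, E)
  let cst : E →L[ℝ] B := LinearMap.toContinuousLinearMap
    { toFun := fun y => ContinuousMap.const _ y
      map_add' := fun _ _ => rfl
      map_smul' := fun _ _ => rfl }
  let g : B → B := fun γ => volterra E (Yc.comp γ)
  have hg : ContDiff ℝ ∞ g :=
    (volterra E).contDiff.comp (ContinuousMap.contDiff_comp_left hY)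
  -- With time rescaled to `[0, 1]`, the trajectory of duration `τ` from `y` solves `γ = y + τ ∫
  -- Y(γ)`, that is, `Ψ (τ, γ) = (τ, cst y)`. At `τ = 0` the derivative of `Ψ` is a shear, hence
  -- invertible, and the flow is the endpoint `γ 1` of the curve given by the local inverse.
  let Ψ : ℝ × B → ℝ × B := fun p => (p.1, p.2 - p.1 • g p.2)
  have hΨ : ContDiff ℝ ∞ Ψ :=
    contDiff_fst.prodMk (contDiff_snd.sub (contDiff_fst.smul (hg.comp contDiff_snd)))
  let x₀ : ℝ × B := (0, cst x)
  let L : (ℝ × B) ≃L[ℝ] (ℝ × B) := ContinuousLinearEquiv.skewProd (.refl ℝ ℝ) (.refl ℝ B)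
    (ContinuousLinearMap.toSpanSingleton ℝ (-(g (cst x))))
  have hL : HasFDerivAt Ψ (L : (ℝ × B) →L[ℝ] (ℝ × B)) x₀ := by
    have hgd : HasFDerivAt (fun p : ℝ × B => g p.2) _ x₀ :=
      ((hg.differentiable (by simp)).differentiableAt.hasFDerivAt (x := x₀.2)).comp x₀
        hasFDerivAt_snd
    have := (hasFDerivAt_fst (𝕜 := ℝ) (p := x₀)).prodMk
      ((hasFDerivAt_snd (𝕜 := ℝ) (p := x₀)).sub ((hasFDerivAt_fst (𝕜 := ℝ) (p := x₀)).smul hgd))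
    refine this.congr_fderiv ?_
    refine ContinuousLinearMap.ext fun p => ?_
    refine Prod.ext rfl ?_
    simp [L, x₀, sub_eq_add_neg]
    exact (smul_neg _ _).symm
  obtain ⟨e, hxe, heΨ, -, hsymm⟩ :=
    (SmoothNear.of_contDiff hΨ (x := x₀)).exists_openPartialHomeomorph L hL
  have hΨx : Ψ x₀ = x₀ := by simp [Ψ, x₀]
  have hex : e x₀ = x₀ := (heΨ x₀).trans hΨx
  have hxt : x₀ ∈ e.target := by simpa [hex] using e.map_source hxe
  have hesx : e.symm x₀ = x₀ := by simpa [hex] using e.left_inv hxe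
  let ι : ℝ × E → ℝ × B := fun p => (p.1, cst p.2)
  have hι : ContDiff ℝ ∞ ι := contDiff_fst.prodMk (cst.contDiff.comp contDiff_snd)
  let ev : B →L[ℝ] E := ContinuousMap.evalCLM ℝ (1 : Set.Icc (0 : ℝ) 1)
  let Φ : ℝ × E → E := fun p => ev (e.symm (ι p)).2
  have hΦ : SmoothNear Φ (0, x) := by
    have hes : SmoothNear e.symm (ι (0, x)) := by
      filter_upwards [e.open_target.mem_nhds hxt] with w hw using hsymm w hw
    have h1 : SmoothNear (fun p => e.symm (ι p)) (0, x) := hes.comp (SmoothNear.of_contDiff hι)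
    exact SmoothNear.contDiff_comp (h := fun q : ℝ × B => ev q.2)
      (ev.contDiff.comp contDiff_snd) h1
  -- A sup-norm ball about `(0, cst x)` is stable under `(τ, γ) ↦ (s τ, rescale s γ)`, unlike
  -- `e.source` itself. Injectivity of `e` then identifies the rescaled curve with the solution for
  -- time `s τ`, so `Φ (s τ, y) = γ s`.
  obtain ⟨ρ, hρ, hball⟩ := Metric.mem_nhds_iff.1 (e.open_source.mem_nhds hxe)
  have hιx : Tendsto ι (𝓝 (0, x)) (𝓝 x₀) := hι.continuous.tendsto _
  have hnear : ∀ᶠ p in 𝓝 ((0 : ℝ), x), ι p ∈ e.target ∧ e.symm (ι p) ∈ Metric.ball x₀ ρ := by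
    have hb : ∀ᶠ q in 𝓝 x₀, e.symm q ∈ Metric.ball x₀ ρ :=
      e.continuousAt_symm hxt (by rw [hesx]; exact Metric.ball_mem_nhds _ hρ)
    exact (hιx.eventually (e.open_target.mem_nhds hxt)).and (hιx.eventually hb)
  have key : ∀ᶠ p in 𝓝 ((0 : ℝ), x), ∃ γ : B, ∀ s : Set.Icc (0 : ℝ) 1,
      Φ (s * p.1, p.2) = γ s ∧ γ s = p.2 + p.1 • volterra E (Yc.comp γ) s := by
    filter_upwards [hnear] with ⟨τ, y⟩ ⟨ht, hb⟩
    obtain ⟨⟨τ', γ⟩, hq⟩ : ∃ q, e.symm (ι (τ, y)) = q := ⟨_, rfl⟩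
    have hinv := e.right_inv ht
    rw [hq] at hinv hb
    rw [heΨ] at hinv
    obtain rfl : τ' = τ := congrArg Prod.fst hinv
    have hγ : γ - τ' • g γ = cst y := congrArg Prod.snd hinv
    refine ⟨γ, fun s => ⟨?_, ?_⟩⟩
    · have hs : ((s * τ', rescale s γ) : ℝ × B) ∈ e.source := by
        apply hball
        rw [Metric.mem_ball, dist_eq_norm, Prod.norm_def, max_lt_iff] at hb ⊢
        constructor
        · refine lt_of_le_of_lt ?_ hb.1
          simp only [x₀, Prod.fst_sub, sub_zero, norm_mul]
          exact mul_le_of_le_one_left (norm_nonneg _)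
            (by rw [Real.norm_of_nonneg s.2.1]; exact s.2.2)
        · refine lt_of_le_of_lt ?_ hb.2
          rw [ContinuousMap.norm_le _ (norm_nonneg _)]
          intro r
          exact (γ - cst x).norm_coe_le_norm (s * r)
      have hi : e (s * τ', rescale s γ) = ι (s * τ', y) := by
        rw [heΨ]
        refine Prod.ext rfl ?_
        change rescale s γ - ((s : ℝ) * τ') • volterra E (Yc.comp (rescale s γ)) = cst y
        rw [mul_comm, mul_smul, rescale_comp, volterra_rescale]
        ext r
        exact congrArg (fun η : B => η (s * r)) hγ
      have : e.symm (ι (s * τ', y)) = (s * τ', rescale s γ) := by rw [← hi, e.left_inv hs]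
      change ev (e.symm (ι (s * τ', y))).2 = γ s
      rw [this]
      change γ (s * 1) = γ s
      rw [mul_one]
    · have := congrArg (fun η : B => η s) hγ
      exact sub_eq_iff_eq_add.1 this
  -- Differentiate `s ↦ Φ (s τ, y)` at `s = 1` in two ways: by the chain rule and from the integral
  -- equation. Both carry a factor `τ`, removed at the end by continuity.
  have hderiv : ∀ᶠ p in 𝓝 ((0 : ℝ), x), p.1 • (_root_.fderiv ℝ Φ p (1, 0) - Y (Φ p)) = 0 := by
    filter_upwards [key, hΦ.eventually_differentiableAt] with ⟨τ, y⟩ ⟨γ, hγ⟩ hd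
    have h1 : HasDerivWithinAt (fun s : ℝ => Φ (s * τ, y)) (_root_.fderiv ℝ Φ (τ, y) (τ, 0))
        (Set.Icc 0 1) 1 := by
      have hc : HasDerivAt (fun s : ℝ => ((s * τ, y) : ℝ × E)) (τ, 0) 1 := by
        simpa using ((hasDerivAt_id (1 : ℝ)).mul_const τ).prodMk (hasDerivAt_const (1 : ℝ) y)
      have hd' : HasFDerivAt Φ (_root_.fderiv ℝ Φ (τ, y)) ((fun s : ℝ => (s * τ, y)) 1) := by
        simpa using hd.hasFDerivAt
      exact (hd'.comp_hasDerivAt 1 hc).hasDerivWithinAt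
    have h2 : HasDerivWithinAt (fun s : ℝ => Φ (s * τ, y)) (τ • Y (Φ (τ, y)))
        (Set.Icc 0 1) 1 := by
      have hcont : Continuous fun r : ℝ => Y (γ (Set.projIcc 0 1 zero_le_one r)) := by
        have := hY.continuous
        fun_prop
      have hi := (hcont.integral_hasStrictDerivAt 0 1).hasDerivAt
      have e1 : Φ (τ, y) = γ (Set.projIcc 0 1 zero_le_one (1 : ℝ)) := by
        rw [Set.projIcc_right]
        have := (hγ 1).1
        simpa using this
      rw [e1]
      refine (((hi.const_smul τ).const_add y).hasDerivWithinAt).congr_of_mem ?_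
        (Set.right_mem_Icc.2 zero_le_one)
      intro s hs
      have := hγ ⟨s, hs⟩
      exact this.1.trans this.2
    have h3 := (uniqueDiffOn_Icc (zero_lt_one' ℝ) 1 (Set.right_mem_Icc.2 zero_le_one)).eq_deriv
      _ h1 h2
    have e2 : ((τ, 0) : ℝ × E) = τ • (1, 0) := by simp
    rw [e2, map_smul] at h3
    simp only [smul_sub, h3, sub_self]
  refine ⟨Φ, hΦ, ?_, ?_⟩
  · have hc : Tendsto (fun y : E => ((0 : ℝ), y)) (𝓝 x) (𝓝 (0, x)) :=
      (Continuous.prodMk_right (0 : ℝ)).tendsto x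
    filter_upwards [hc.eventually key] with y ⟨γ, hγ⟩
    have := hγ 0
    have h2 := this.1.trans this.2
    simpa using h2
  · have hΦx : Φ (0, x) = x := by
      change ev (e.symm x₀).2 = x
      rw [hesx]
      rfl
    have hYX' : ∀ᶠ p in 𝓝 ((0 : ℝ), x), Y (Φ p) = X (Φ p) :=
      hΦ.continuousAt.eventually (by rw [hΦx]; exact hYX)
    filter_upwards [eventually_eventually_nhds.2 hderiv, hΦ.eventually_smoothNear, hYX']
      with p hp hs hp'
    rw [← hp']
    refine sub_eq_zero.1 (eq_zero_of_eventually_smul_eq_zero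
      (g := fun p => _root_.fderiv ℝ Φ p (1, 0) - Y (Φ p)) ?_ hp)
    exact (hs.fderiv.continuousAt.clm_apply continuousAt_const).sub
      (hY.continuous.continuousAt.comp hs.continuousAt)

/-! ### Smoothness and closedness of pulled-back forms. -/

section FiniteDimensional

variable {E F X : Type*} [NormedAddCommGroup E] [NormedSpace ℝ E] [FiniteDimensional ℝ E]
  [NormedAddCommGroup F] [NormedSpace ℝ F] [NormedAddCommGroup X] [NormedSpace ℝ X] {q : ℕ}

instance ContinuousMultilinearMap.instFiniteDimensionalReal :
    FiniteDimensional ℝ (ContinuousMultilinearMap ℝ (fun _ : Fin q => E) ℝ) :=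
  Module.Finite.of_injective
    (ContinuousMultilinearMap.toMultilinearMapLinear (R' := ℝ) (A := ℝ) (M₁ := fun _ : Fin q => E)
      (M₂ := ℝ)) ContinuousMultilinearMap.toMultilinearMap_injective

instance ContinuousAlternatingMap.instFiniteDimensionalReal :
    FiniteDimensional ℝ (E [⋀^Fin q]→L[ℝ] ℝ) :=
  Module.Finite.of_injective
    (ContinuousAlternatingMap.toContinuousMultilinearMapLinear (R := ℝ) (A := ℝ) (M := E) (N := ℝ)
      (ι := Fin q)) ContinuousAlternatingMap.toContinuousMultilinearMap_injective

/-- Composition is smooth for multilinear maps, being multilinear in the inner maps; a linear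
retraction `S` onto alternating maps, continuous by finite dimension, carries this over. -/
theorem ContDiffAt.continuousAlternatingMap_comp {c : X → F [⋀^Fin q]→L[ℝ] ℝ}
    {A : X → E →L[ℝ] F} {x : X} (hc : ContDiffAt ℝ ∞ c x) (hA : ContDiffAt ℝ ∞ A x) :
    ContDiffAt ℝ ∞ (fun z => (c z).compContinuousLinearMap (A z)) x := by
  obtain ⟨S, hS⟩ := LinearMap.exists_leftInverse_of_injective
    (ContinuousAlternatingMap.toContinuousMultilinearMapLinear (R := ℝ) (A := ℝ) (M := E) (N := ℝ)
      (ι := Fin q))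
    (LinearMap.ker_eq_bot.2 ContinuousAlternatingMap.toContinuousMultilinearMap_injective)
  let S' := LinearMap.toContinuousLinearMap S
  let T := ContinuousAlternatingMap.toContinuousMultilinearMapCLM (𝕜 := ℝ) (E := F) (F := ℝ)
    (ι := Fin q) ℝ
  let M := ContinuousMultilinearMap.compContinuousLinearMapContinuousMultilinear ℝ
    (fun _ : Fin q => E) (fun _ : Fin q => F) ℝ
  have h : ContDiffAt ℝ ∞ (fun z => S' (M (fun _ => A z) (T (c z)))) x := by
    have hM : ContDiff ℝ ∞ (fun B : Fin q → (E →L[ℝ] F) => M B) :=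
      @ContinuousMultilinearMap.contDiff ℝ _
        (ContinuousMultilinearMap ℝ (fun _ : Fin q => F) ℝ →L[ℝ]
          ContinuousMultilinearMap ℝ (fun _ : Fin q => E) ℝ) _ _ (Fin q)
        (fun _ => E →L[ℝ] F) _ _ _ M _
    have hB : ContDiffAt ℝ ∞ (fun z => fun _ : Fin q => A z) x := contDiffAt_pi.2 fun _ => hA
    have h1 : ContDiffAt ℝ ∞ (fun z => M (fun _ => A z)) x := hM.contDiffAt.comp x hB
    exact S'.contDiff.contDiffAt.comp x (h1.clm_apply (T.contDiff.contDiffAt.comp x hc))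
  convert h using 2 with z
  have := LinearMap.congr_fun hS ((c z).compContinuousLinearMap (A z))
  exact this.symm

theorem SmoothNear.pullback {α : F → F [⋀^Fin q]→L[ℝ] ℝ} {f : E → F} {x : E}
    (hα : SmoothNear α (f x)) (hf : SmoothNear f x) :
    SmoothNear (fun z => (α (f z)).compContinuousLinearMap (_root_.fderiv ℝ f z)) x := by
  filter_upwards [hα.comp hf, hf.fderiv] with z h1 h2
  exact h1.continuousAlternatingMap_comp h2

end FiniteDimensional

theorem eventually_extDeriv_pullback {E F : Type*} [NormedAddCommGroup E] [NormedSpace ℝ E]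
    [NormedAddCommGroup F] [NormedSpace ℝ F] {q : ℕ} {α : F → F [⋀^Fin q]→L[ℝ] ℝ} {f : E → F} {x : E}
    (hα : SmoothNear α (f x)) (hf : SmoothNear f x)
    (hd : ∀ᶠ y in 𝓝 (f x), extDeriv α y = 0) :
    ∀ᶠ z in 𝓝 x,
      extDeriv (fun z => (α (f z)).compContinuousLinearMap (fderiv ℝ f z)) z = 0 := by
  filter_upwards [hf, hf.continuousAt.eventually hα.eventually_differentiableAt,
    hf.continuousAt.eventually hd] with z h1 h2 h3
  rw [extDeriv_pullback h2 h1 (by simp; norm_cast), h3]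
  rfl

/-! ### Kernel vectors of alternating forms. -/

namespace ContinuousAlternatingMap

variable {E : Type*} [NormedAddCommGroup E] [NormedSpace ℝ E] {q : ℕ}

theorem apply_eq_zero_of_curryLeft_eq_zero (c : E [⋀^Fin (q + 1)]→L[ℝ] ℝ) {u : E}
    (hu : c.curryLeft u = 0) (w : Fin (q + 1) → E) (k : Fin (q + 1)) (hk : w k = u) : c w = 0 := by
  have h0 : ∀ w : Fin (q + 1) → E, w 0 = u → c w = 0 := by
    intro w hw
    have := congrArg (fun d => d (Fin.tail w)) hu
    rw [curryLeft_apply_apply] at this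
    rw [← Fin.cons_self_tail w, hw]
    exact this
  by_cases hk0 : k = 0
  · subst hk0; exact h0 w hk
  · have := c.map_swap w (i := 0) (j := k) (Ne.symm hk0)
    have h1 : c (w ∘ Equiv.swap 0 k) = 0 := h0 _ (by simpa using hk)
    exact neg_eq_zero.1 (this.symm.trans h1)

/-- Replace the arguments one at a time; each replacement changes the value by a term with a kernel
vector in one slot. -/
theorem apply_congr_of_curryLeft_sub_eq_zero (c : E [⋀^Fin (q + 1)]→L[ℝ] ℝ)
    {w w' : Fin (q + 1) → E} (h : ∀ i, c.curryLeft (w i - w' i) = 0) : c w = c w' := by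
  have key : ∀ s : Finset (Fin (q + 1)), c (s.piecewise w w') = c w' := by
    intro s
    induction s using Finset.induction_on with
    | empty => simp
    | insert a s ha ih =>
      rw [← ih, Finset.piecewise_insert, ← sub_eq_zero]
      have e : s.piecewise w w' = Function.update (s.piecewise w w') a (w' a) := by
        rw [Function.eq_update_iff]
        simp [ha]
      nth_rewrite 2 [e]
      rw [← c.map_update_sub]
      exact c.apply_eq_zero_of_curryLeft_eq_zero (h a) _ a (by simp)
  simpa using key Finset.univ

theorem comp_sub_smulRight_eq_self (c : E [⋀^Fin (q + 1)]→L[ℝ] ℝ) {v : E}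
    (hv : c.curryLeft v = 0) (ℓ : E →L[ℝ] ℝ) (A : E →L[ℝ] E) (hA : ∀ w, A w = w - ℓ w • v) :
    c.compContinuousLinearMap A = c := by
  ext w
  refine c.apply_congr_of_curryLeft_sub_eq_zero (w := A ∘ w) fun i => ?_
  simp [hA, hv]

end ContinuousAlternatingMap

theorem OpenPartialHomeomorph.fderiv_symm_comp {E F : Type*} [NormedAddCommGroup E]
    [NormedSpace ℝ E] [NormedAddCommGroup F]
    [NormedSpace ℝ F] (e : OpenPartialHomeomorph E F)
    {w : F} (hw : w ∈ e.target) (h1 : DifferentiableAt ℝ e (e.symm w))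
    (h2 : DifferentiableAt ℝ e.symm w) :
    (fderiv ℝ e.symm w).comp (fderiv ℝ e (e.symm w)) = .id ℝ E ∧
      (fderiv ℝ e (e.symm w)).comp (fderiv ℝ e.symm w) = .id ℝ F := by
  constructor
  · have h3 : HasFDerivAt (fun z => e.symm (e z)) (.id ℝ E) (e.symm w) :=
      (hasFDerivAt_id _).congr_of_eventuallyEq (e.eventually_left_inverse (e.map_target hw))
    have h2' : HasFDerivAt e.symm (fderiv ℝ e.symm w) (e (e.symm w)) := by
      rw [e.right_inv hw]; exact h2.hasFDerivAt
    exact (h2'.comp _ h1.hasFDerivAt).unique h3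
  · have h3 : HasFDerivAt (fun z => e (e.symm z)) (.id ℝ F) w :=
      (hasFDerivAt_id _).congr_of_eventuallyEq (e.eventually_right_inverse hw)
    exact (h1.hasFDerivAt.comp _ h2.hasFDerivAt).unique h3

theorem exists_dual_eq_one {E : Type*} [NormedAddCommGroup E] [NormedSpace ℝ E] {v : E} (hv : v ≠ 0) : ∃ ℓ : E →L[ℝ] ℝ, ℓ v = 1 :=
  SeparatingDual.exists_eq_one hv

/-! ### Straightening a nonvanishing vector field. -/

section Straightening

variable {E : Type*} [NormedAddCommGroup E] [NormedSpace ℝ E] [FiniteDimensional ℝ E]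

/-- Near a zero-free point, a smooth vector field is constant in suitable coordinates. -/
theorem SmoothNear.exists_straightening {X : E → E} {x : E} (hX : SmoothNear X x) (ℓ : E →L[ℝ] ℝ)
    (hℓ : ℓ (X x) = 1) :
    ∃ e : OpenPartialHomeomorph E E, x ∈ e.source ∧ e x = x ∧
      (∀ z ∈ e.source, ContDiffAt ℝ ∞ e z) ∧ (∀ w ∈ e.target, ContDiffAt ℝ ∞ e.symm w) ∧
      ∀ᶠ z in 𝓝 x, _root_.fderiv ℝ e z (X x) = X (e z) := by
  obtain ⟨Φ, hΦ, hΦ0, hΦX⟩ := hX.exists_flow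
  have : CompleteSpace E := FiniteDimensional.complete ℝ E
  set v := X x with hv
  -- `Φ (A z)` starts at the projection of `z` along `v` to the hyperplane `ℓ = ℓ x` and flows for
  -- time `ℓ (z - x)`. Since `A' v = (1, 0)`, it carries `v` to `X`.
  let A : E → ℝ × E := fun z => (ℓ (z - x), z - ℓ (z - x) • v)
  have hA : ContDiff ℝ ∞ A := by fun_prop
  have hAx : A x = (0, x) := by simp [A]
  let A' : E →L[ℝ] ℝ × E := ℓ.prod (.id ℝ E - ℓ.smulRight v)
  have hA' : ∀ z, HasFDerivAt A A' z := by
    intro z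
    have h1 : HasFDerivAt (fun z => ℓ (z - x)) ℓ z :=
      ℓ.hasFDerivAt.comp z ((hasFDerivAt_id z).sub_const x)
    exact h1.prodMk ((hasFDerivAt_id z).sub (h1.smul_const v))
  let Ψ : E → E := fun z => Φ (A z)
  have hΨ : SmoothNear Ψ x := SmoothNear.comp (hAx ▸ hΦ) (SmoothNear.of_contDiff hA)
  have hAt : Tendsto A (𝓝 x) (𝓝 (0, x)) := hAx ▸ hA.continuous.tendsto x
  have hΨ' : ∀ᶠ z in 𝓝 x, HasFDerivAt Ψ ((_root_.fderiv ℝ Φ (A z)).comp A') z :=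
    (hAt.eventually hΦ.eventually_differentiableAt).mono fun z hz => hz.hasFDerivAt.comp z (hA' z)
  have hΨx : Ψ x = x := by
    change Φ (A x) = x
    rw [hAx]
    exact hΦ0.self_of_nhds
  have hv1 : _root_.fderiv ℝ Φ (0, x) (1, 0) = v := by
    have := hΦX.self_of_nhds
    rwa [hΦ0.self_of_nhds] at this
  have hv2 : ∀ w, _root_.fderiv ℝ Φ (0, x) (0, w) = w := by
    intro w
    have h1 : HasFDerivAt (fun y => Φ (0, y))
        ((_root_.fderiv ℝ Φ (0, x)).comp (.inr ℝ ℝ E)) x :=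
      HasFDerivAt.comp x (g := Φ) (f := fun y : E => ((0 : ℝ), y))
        hΦ.differentiableAt.hasFDerivAt (hasFDerivAt_prodMk_right (0 : ℝ) x)
    have h2 : HasFDerivAt (fun y => Φ (0, y)) (.id ℝ E) x :=
      (hasFDerivAt_id x).congr_of_eventuallyEq hΦ0
    exact congrArg (fun B : E →L[ℝ] E => B w) (h1.unique h2)
  have hid : HasFDerivAt Ψ ((ContinuousLinearEquiv.refl ℝ E : E ≃L[ℝ] E) : E →L[ℝ] E) x := by
    refine hΨ'.self_of_nhds.congr_fderiv ?_
    ext w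
    have e1 : A' w = ℓ w • ((1 : ℝ), (0 : E)) + ((0 : ℝ), w - ℓ w • v) := by
      simp [A']
    simp only [ContinuousLinearMap.comp_apply]
    rw [hAx, e1, map_add, map_smul, hv1, hv2]
    simp
  obtain ⟨e, hxe, heΨ, h1, h2⟩ := hΨ.exists_openPartialHomeomorph (.refl ℝ E) hid
  have heq : (e : E → E) = Ψ := funext heΨ
  refine ⟨e, hxe, by rw [heq, hΨx], by rwa [heq], h2, ?_⟩
  rw [heq]
  filter_upwards [hΨ', hAt.eventually hΦX] with z hz hz'
  rw [hz.fderiv]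
  have e1 : A' v = ((1 : ℝ), (0 : E)) := by simp [A', hℓ]
  rw [ContinuousLinearMap.comp_apply, e1, hz']

/-- A smooth vector field has a smooth time function near a zero-free point. -/
theorem SmoothNear.exists_time_function {X : E → E} {x : E} (hX : SmoothNear X x)
    (hx : X x ≠ 0) :
    ∃ u : E → ℝ, SmoothNear u x ∧ ∀ᶠ z in 𝓝 x, _root_.fderiv ℝ u z (X z) = 1 := by
  obtain ⟨ℓ, hℓ⟩ := exists_dual_eq_one hx
  obtain ⟨e, hxe, hex, h1, h2, h3⟩ := hX.exists_straightening ℓ hℓ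
  have hxt : x ∈ e.target := hex ▸ e.map_source hxe
  have hsx : e.symm x = x := by rw [← hex, e.left_inv hxe, hex]
  have hcont : Tendsto e.symm (𝓝 x) (𝓝 x) := by
    have := e.continuousAt_symm hxt
    rwa [ContinuousAt, hsx] at this
  have hs : SmoothNear e.symm x := by
    filter_upwards [e.open_target.mem_nhds hxt] with w hw using h2 w hw
  refine ⟨fun z => ℓ (e.symm z), SmoothNear.contDiff_comp ℓ.contDiff hs, ?_⟩
  filter_upwards [hcont.eventually h3, e.open_target.mem_nhds hxt] with z hz hzt
  have hd := (h2 z hzt).differentiableAt (by simp)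
  have hd' := (h1 _ (e.map_target hzt)).differentiableAt (by simp)
  rw [e.right_inv hzt] at hz
  have hc : HasFDerivAt (fun z => ℓ (e.symm z)) (ℓ.comp (_root_.fderiv ℝ e.symm z)) z :=
    ℓ.hasFDerivAt.comp z hd.hasFDerivAt
  have h4 := congrArg (fun B : E →L[ℝ] E => B (X x)) (e.fderiv_symm_comp hzt hd' hd).1
  simp only [ContinuousLinearMap.comp_apply, hz] at h4
  rw [hc.fderiv, ContinuousLinearMap.comp_apply, h4]
  simpa using hℓ

end Straightening

/-! ### Reduction of a closed form along a kernel field. -/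

section Reduction

variable {E : Type*} [NormedAddCommGroup E] [NormedSpace ℝ E] {q : ℕ}

/-- A closed form annihilated by a constant vector field does not vary along it. -/
theorem fderiv_apply_eq_zero_of_closed {α : E → E [⋀^Fin (q + 1)]→L[ℝ] ℝ} {x v : E}
    (hα : DifferentiableAt ℝ α x) (hd : extDeriv α x = 0)
    (hv : ∀ᶠ z in 𝓝 x, (α z).curryLeft v = 0) : fderiv ℝ α x v = 0 := by
  ext w
  -- In the alternating sum for `dα(v, w)`, every term but the first differentiates a value of `α`
  -- with `v` among its arguments, which vanishes near `x`.
  have h := congrArg (fun c => c (Fin.cons v w : Fin (q + 2) → E)) hd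
  simp only [extDeriv_apply hα] at h
  rw [Fin.sum_univ_succ, Finset.sum_eq_zero] at h
  · simp only [Fin.removeNth_zero, Fin.tail_cons, Fin.cons_zero] at h
    rw [fderiv_continuousAlternatingMap_apply_const_apply hα] at h
    simpa using h
  · intro i _
    have : (fun y => α y (i.succ.removeNth (Fin.cons v w : Fin (q + 2) → E))) =ᶠ[𝓝 x]
        fun _ => 0 := by
      filter_upwards [hv] with y hy
      exact (α y).apply_eq_zero_of_curryLeft_eq_zero hy _ 0
        (by simp [Fin.removeNth_apply])
    rw [this.fderiv_eq]
    simp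

/-- A function whose derivative along `v` vanishes near `x` is constant on short segments in
direction `v`. -/
theorem eventually_eq_sub_smul {F : Type*} [NormedAddCommGroup F] [NormedSpace ℝ F] {f : E → F}
    {x v : E} (hf : ∀ᶠ z in 𝓝 x, DifferentiableAt ℝ f z)
    (hv : ∀ᶠ z in 𝓝 x, fderiv ℝ f z v = 0) (ℓ : E →L[ℝ] ℝ) :
    ∀ᶠ z in 𝓝 x, f z = f (z - ℓ (z - x) • v) := by
  obtain ⟨r, hr, h⟩ := Metric.eventually_nhds_iff_ball.1 (hf.and hv)
  have hc : Tendsto (fun z => z - ℓ (z - x) • v) (𝓝 x) (𝓝 x) := by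
    have : Continuous fun z => z - ℓ (z - x) • v := by fun_prop
    simpa using this.tendsto x
  filter_upwards [hc.eventually (Metric.ball_mem_nhds x hr), Metric.ball_mem_nhds x hr]
    with z hz hz'
  have hseg : ∀ t ∈ Set.Icc (0 : ℝ) 1, z - (t * ℓ (z - x)) • v ∈ Metric.ball x r := by
    intro t ht
    have := (convex_ball x r) hz' hz (a := 1 - t) (b := t) (by linarith [ht.2]) ht.1 (by ring)
    convert this using 1
    module
  have hd : ∀ t ∈ Set.Icc (0 : ℝ) 1,
      HasDerivAt (fun t : ℝ => f (z - (t * ℓ (z - x)) • v)) 0 t := by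
    intro t ht
    obtain ⟨h1, h2⟩ := h _ (hseg t ht)
    have h3 : HasDerivAt (fun t : ℝ => z - (t * ℓ (z - x)) • v) (-((1 * ℓ (z - x)) • v)) t :=
      (((hasDerivAt_id t).mul_const _).smul_const v).const_sub z
    have h4 := h1.hasFDerivAt.comp_hasDerivAt t h3
    refine h4.congr_deriv ?_
    rw [map_neg, map_smul, h2, smul_zero, neg_zero]
  have := constant_of_has_deriv_right_zero (a := 0) (b := 1)
    (fun t ht => (hd t ht).continuousAt.continuousWithinAt)
    (fun t ht => (hd t ⟨ht.1, ht.2.le⟩).hasDerivWithinAt) 1 (by simp)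
  simpa using this.symm

/-- A closed form annihilated by a nonvanishing vector field is locally the pullback of a closed
form under a submersion onto a space of dimension one less. -/
theorem exists_reduction [FiniteDimensional ℝ E] {α : E → E [⋀^Fin (q + 1)]→L[ℝ] ℝ} {x : E}
    (hα : SmoothNear α x) (hd : ∀ᶠ z in 𝓝 x, extDeriv α z = 0) {X : E → E} (hX : SmoothNear X x)
    (hXx : X x ≠ 0) (hker : ∀ᶠ z in 𝓝 x, (α z).curryLeft (X z) = 0) :
    ∃ (H : Submodule ℝ E) (π : E → H) (β : H → H [⋀^Fin (q + 1)]→L[ℝ] ℝ),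
      Module.finrank ℝ H + 1 = Module.finrank ℝ E ∧ SmoothNear π x ∧
      Function.Surjective (fderiv ℝ π x) ∧ SmoothNear β (π x) ∧
      (∀ᶠ h in 𝓝 (π x), extDeriv β h = 0) ∧
      ∀ᶠ z in 𝓝 x, α z = (β (π z)).compContinuousLinearMap (fderiv ℝ π z) := by
  obtain ⟨ℓ, hℓ⟩ := exists_dual_eq_one hXx
  obtain ⟨e, hxe, hex, h1, h2, h3⟩ := hX.exists_straightening ℓ hℓ
  set v := X x with hv
  have hxt : x ∈ e.target := hex ▸ e.map_source hxe
  have hsx : e.symm x = x := by rw [← hex, e.left_inv hxe, hex]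
  have hcont : Tendsto e.symm (𝓝 x) (𝓝 x) := by
    have := e.continuousAt_symm hxt
    rwa [ContinuousAt, hsx] at this
  have hs : SmoothNear e.symm x := by
    filter_upwards [e.open_target.mem_nhds hxt] with w hw using h2 w hw
  have he : SmoothNear e x := by
    filter_upwards [e.open_source.mem_nhds hxe] with w hw using h1 w hw
  have hecont : Tendsto e (𝓝 x) (𝓝 x) := by
    have := he.continuousAt
    rwa [ContinuousAt, hex] at this
  let α' : E → E [⋀^Fin (q + 1)]→L[ℝ] ℝ :=
    fun z => (α (e z)).compContinuousLinearMap (fderiv ℝ e z)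
  have hα' : SmoothNear α' x := SmoothNear.pullback (hex.symm ▸ hα) he
  have hd' : ∀ᶠ z in 𝓝 x, extDeriv α' z = 0 :=
    eventually_extDeriv_pullback (hex.symm ▸ hα) he (hex.symm ▸ hd)
  have hv' : ∀ᶠ z in 𝓝 x, (α' z).curryLeft v = 0 := by
    filter_upwards [h3, hecont.eventually hker] with z hz hz'
    simp only [α', ContinuousAlternatingMap.curryLeft_compContinuousLinearMap, hz, hz']
    rfl
  have hconst : ∀ᶠ z in 𝓝 x, α' z = α' (z - ℓ (z - x) • v) := by
    refine eventually_eq_sub_smul hα'.eventually_differentiableAt ?_ ℓ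
    filter_upwards [hα'.eventually_differentiableAt, hd', eventually_eventually_nhds.2 hv']
      with z hz1 hz2 hz3
    exact fderiv_apply_eq_zero_of_closed hz1 hz2 hz3
  let H : Submodule ℝ E := LinearMap.ker (ℓ : E →ₗ[ℝ] ℝ)
  let p : E →L[ℝ] H := (ContinuousLinearMap.id ℝ E - ℓ.smulRight v).codRestrict H (fun z => by
    simp [H, hℓ])
  have hp : ∀ z, (p z : E) = z - ℓ z • v := fun z => rfl
  -- The translation moves `ker ℓ` to the parallel hyperplane through `x`, making `a ∘ p` the
  -- projection along `v` that occurs in `hconst`.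
  let a : H → E := fun h => h + ℓ x • v
  have ha : ContDiff ℝ ∞ a := H.subtypeL.contDiff.add contDiff_const
  have ha' : ∀ h, HasFDerivAt a H.subtypeL h := fun h => H.subtypeL.hasFDerivAt.add_const _
  have hap : ∀ z, a (p z) = z - ℓ (z - x) • v := by
    intro z
    simp only [a, hp, map_sub]
    module
  have hapx : a (p x) = x := by simp [hap]
  let β : H → H [⋀^Fin (q + 1)]→L[ℝ] ℝ := fun h => (α' (a h)).compContinuousLinearMap
    (fderiv ℝ a h)
  let π : E → H := fun z => p (e.symm z)
  have hπx : π x = p x := by simp [π, hsx]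
  have hπ' : ∀ z ∈ e.target, HasFDerivAt π (p.comp (fderiv ℝ e.symm z)) z := by
    intro z hz
    exact p.hasFDerivAt.comp z ((h2 z hz).differentiableAt (by simp)).hasFDerivAt
  have hapπ : a (π x) = x := by rw [hπx, hapx]
  refine ⟨H, π, β, ?_, SmoothNear.contDiff_comp p.contDiff hs, ?_,
    SmoothNear.pullback (hapπ.symm ▸ hα') (.of_contDiff ha),
    eventually_extDeriv_pullback (hapπ.symm ▸ hα') (.of_contDiff ha) (hapπ.symm ▸ hd'), ?_⟩
  · have hr := (ℓ : E →ₗ[ℝ] ℝ).finrank_range_add_finrank_ker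
    have hsurj : LinearMap.range (ℓ : E →ₗ[ℝ] ℝ) = ⊤ := by
      rw [LinearMap.range_eq_top]
      intro t
      exact ⟨t • v, by simp [hℓ]⟩
    rw [hsurj, finrank_top, Module.finrank_self] at hr
    rw [← hr, add_comm]
  · intro h
    rw [(hπ' x hxt).fderiv]
    have h4 := congrArg (fun B : E →L[ℝ] E => B h) (e.fderiv_symm_comp hxt
      ((h1 _ (e.map_target hxt)).differentiableAt (by simp))
      ((h2 _ hxt).differentiableAt (by simp))).1
    refine ⟨fderiv ℝ e (e.symm x) h, Subtype.ext ?_⟩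
    simp only [ContinuousLinearMap.comp_apply] at h4 ⊢
    rw [h4, hp]
    have : ℓ h = 0 := h.2
    simp [this]
  · filter_upwards [e.open_target.mem_nhds hxt, hcont.eventually hconst, hcont.eventually hv']
      with z hz hc hk
    have hI := (e.fderiv_symm_comp hz
      ((h1 _ (e.map_target hz)).differentiableAt (by simp))
      ((h2 _ hz).differentiableAt (by simp))).2
    have e1 : α z = (α' (e.symm z)).compContinuousLinearMap (fderiv ℝ e.symm z) := by
      ext w
      have : ∀ i, fderiv ℝ e (e.symm z) (fderiv ℝ e.symm z (w i)) = w i := fun i =>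
        congrArg (fun B : E →L[ℝ] E => B (w i)) hI
      simp [α', e.right_inv hz, Function.comp_def, this]
    -- Both dependences on `v` disappear: projecting the arguments is harmless because `v` is in the
    -- kernel, and projecting the base point because of `hconst`.
    have e2 := (α' (e.symm z)).comp_sub_smulRight_eq_self hk ℓ (H.subtypeL.comp p) (fun w => hp w)
    rw [(hπ' z hz).fderiv, e1]
    conv_lhs => rw [← e2, hc, ← hap]
    ext w
    simp only [β, π, (ha' _).fderiv]
    rfl

end Reduction

/-! ### Forms of constant rank and their kernel fields. -/

section Rank

variable {E F : Type*} [NormedAddCommGroup E] [NormedSpace ℝ E] [NormedAddCommGroup F]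
  [NormedSpace ℝ F] {q : ℕ}

/-- The rank of an alternating form: the codimension of its kernel. -/
noncomputable def formRank (c : E [⋀^Fin (q + 1)]→L[ℝ] ℝ) : ℕ :=
  Module.finrank ℝ (LinearMap.range (c.curryLeft : E →ₗ[ℝ] E [⋀^Fin q]→L[ℝ] ℝ))

theorem formRank_add_finrank_ker [FiniteDimensional ℝ E] (c : E [⋀^Fin (q + 1)]→L[ℝ] ℝ) :
    formRank c + Module.finrank ℝ (LinearMap.ker (c.curryLeft : E →ₗ[ℝ] E [⋀^Fin q]→L[ℝ] ℝ)) =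
      Module.finrank ℝ E :=
  LinearMap.finrank_range_add_finrank_ker _

theorem formRank_comp (c : F [⋀^Fin (q + 1)]→L[ℝ] ℝ) (A : E →L[ℝ] F)
    (hA : Function.Surjective A) : formRank (c.compContinuousLinearMap A) = formRank c := by
  let T : (F [⋀^Fin q]→L[ℝ] ℝ) →ₗ[ℝ] (E [⋀^Fin q]→L[ℝ] ℝ) :=
    (ContinuousAlternatingMap.compContinuousLinearMapCLM A :
      (F [⋀^Fin q]→L[ℝ] ℝ) →L[ℝ] (E [⋀^Fin q]→L[ℝ] ℝ)).toLinearMap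
  have hT : Function.Injective T := by
    intro a b hab
    ext w
    choose u hu using fun i => hA (w i)
    have := congrArg (fun d => d u) hab
    have e : A ∘ u = w := funext hu
    change a (A ∘ u) = b (A ∘ u) at this
    rwa [e] at this
  have h : ((c.compContinuousLinearMap A).curryLeft : E →ₗ[ℝ] E [⋀^Fin q]→L[ℝ] ℝ) =
      (T ∘ₗ (c.curryLeft : F →ₗ[ℝ] F [⋀^Fin q]→L[ℝ] ℝ)) ∘ₗ (A : E →ₗ[ℝ] F) := by
    ext u
    simp [T, ContinuousAlternatingMap.curryLeft_compContinuousLinearMap]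
  rw [formRank, h, LinearMap.range_comp_of_range_eq_top _ (LinearMap.range_eq_top.2 hA),
    LinearMap.range_comp]
  exact (Submodule.equivMapOfInjective T hT _).symm.finrank_eq

/-- Let `g` be a right inverse of `A x` onto its range `R`, and `P` a projection to `R`. Near `x`
the map `P A_z g` is invertible, so `v` can be corrected by an element of the image of `g` to get `P
A_z Z = 0`. Moreover `P` maps the range of `A z` onto `R`; equality of ranks makes it injective
there, so `A_z Z = 0`. -/
theorem exists_kernel_section {V W : Type*} [NormedAddCommGroup V] [NormedSpace ℝ V]
    [FiniteDimensional ℝ V] [NormedAddCommGroup W] [NormedSpace ℝ W] [FiniteDimensional ℝ W]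
    {A : E → V →L[ℝ] W} {x : E} (hA : SmoothNear A x)
    (hr : ∀ᶠ z in 𝓝 x, Module.finrank ℝ (LinearMap.range (A z : V →ₗ[ℝ] W)) =
      Module.finrank ℝ (LinearMap.range (A x : V →ₗ[ℝ] W)))
    {v : V} (hv : A x v = 0) :
    ∃ Z : E → V, SmoothNear Z x ∧ Z x = v ∧ ∀ᶠ z in 𝓝 x, A z (Z z) = 0 := by
  let R := LinearMap.range (A x : V →ₗ[ℝ] W)
  have : CompleteSpace R := FiniteDimensional.complete ℝ R
  obtain ⟨g₀, hg₀⟩ := (A x : V →ₗ[ℝ] W).rangeRestrict.exists_rightInverse_of_surjective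
    (LinearMap.range_rangeRestrict _)
  obtain ⟨P₀, hP₀⟩ := R.subtype.exists_leftInverse_of_injective R.ker_subtype
  let g : R →L[ℝ] V := LinearMap.toContinuousLinearMap g₀
  let P : W →L[ℝ] R := LinearMap.toContinuousLinearMap P₀
  let B : E → R →L[ℝ] R := fun z => P.comp ((A z).comp g)
  have hB : SmoothNear B x := SmoothNear.clm_comp (.of_contDiff contDiff_const)
    (SmoothNear.clm_comp hA (.of_contDiff contDiff_const))
  have hBx : B x = (ContinuousLinearEquiv.refl ℝ R : R ≃L[ℝ] R) := by
    ext r : 1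
    have h1 := LinearMap.congr_fun hg₀ r
    have h2 : A x (g₀ r) = (r : W) := congrArg Subtype.val h1
    change P₀ (A x (g₀ r)) = r
    rw [h2]
    exact LinearMap.congr_fun hP₀ r
  have hBr : ∀ᶠ z in 𝓝 x, B z ∈ Set.range ((↑) : (R ≃L[ℝ] R) → R →L[ℝ] R) :=
    hB.continuousAt (by rw [hBx]; exact ContinuousLinearEquiv.nhds _)
  refine ⟨fun z => v - g ((B z).inverse (P (A z v))), ?_, ?_, ?_⟩
  · refine SmoothNear.sub (.of_contDiff contDiff_const) (.contDiff_comp g.contDiff ?_)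
    refine SmoothNear.clm_apply (hB.inverse _ hBx) (.contDiff_comp P.contDiff ?_)
    exact SmoothNear.clm_apply hA (.of_contDiff contDiff_const)
  · simp [hv]
  · filter_upwards [hBr, hr] with z ⟨e, he⟩ hrz
    set Z := v - g ((B z).inverse (P (A z v))) with hZ
    have h1 : P (A z Z) = 0 := by
      have h2 : P (A z (g ((B z).inverse (P (A z v))))) = P (A z v) := by
        change B z ((B z).inverse (P (A z v))) = _
        rw [← he, ContinuousLinearMap.inverse_equiv]
        simp
      rw [hZ, map_sub, map_sub, h2, sub_self]
    let Q : LinearMap.range (A z : V →ₗ[ℝ] W) →ₗ[ℝ] R :=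
      (P : W →ₗ[ℝ] R) ∘ₗ (LinearMap.range (A z : V →ₗ[ℝ] W)).subtype
    have hQs : Function.Surjective Q := by
      intro r
      refine ⟨⟨A z (g (e.symm r)), ⟨_, rfl⟩⟩, ?_⟩
      change B z (e.symm r) = r
      rw [← he]
      simp
    have hQi := (LinearMap.injective_iff_surjective_of_finrank_eq_finrank hrz).2 hQs
    have h3 : (⟨A z Z, ⟨Z, rfl⟩⟩ : LinearMap.range (A z : V →ₗ[ℝ] W)) = 0 :=
      hQi (by rw [map_zero]; exact h1)
    exact congrArg Subtype.val h3

theorem contDiff_curryLeft :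
    ContDiff ℝ ∞ fun c : E [⋀^Fin (q + 1)]→L[ℝ] ℝ => c.curryLeft :=
  LinearIsometry.contDiff (𝕜 := ℝ) (E := E [⋀^Fin (q + 1)]→L[ℝ] ℝ)
    (F := E →L[ℝ] E [⋀^Fin q]→L[ℝ] ℝ) ContinuousAlternatingMap.curryLeftLI

/-- A form of locally constant rank with nontrivial kernel is annihilated by a smooth
vector field extending a given kernel vector. -/
theorem exists_annihilating_vectorField [FiniteDimensional ℝ E]
    {α : E → E [⋀^Fin (q + 1)]→L[ℝ] ℝ} {x : E} (hα : SmoothNear α x)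
    (hr : ∀ᶠ z in 𝓝 x, formRank (α z) = formRank (α x)) {v : E} (hv : (α x).curryLeft v = 0) :
    ∃ X : E → E, SmoothNear X x ∧ X x = v ∧ ∀ᶠ z in 𝓝 x, (α z).curryLeft (X z) = 0 :=
  exists_kernel_section
    (SmoothNear.contDiff_comp (h := fun c : E [⋀^Fin (q + 1)]→L[ℝ] ℝ => c.curryLeft)
      contDiff_curryLeft hα) hr hv

end Rank

/-! ### Rectifiable forms and submersions. -/

section Rectifiable

variable {E G : Type*} [NormedAddCommGroup E] [NormedSpace ℝ E]
  [NormedAddCommGroup G] [NormedSpace ℝ G] [FiniteDimensional ℝ G] {q : ℕ}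

/-- Near `x`, the form `α` is the pullback of a constant form under a local diffeomorphism. -/
def Rectifiable (α : E → E [⋀^Fin q]→L[ℝ] ℝ) (x : E) : Prop :=
  ∃ (Ψ : E → E) (c : E [⋀^Fin q]→L[ℝ] ℝ), SmoothNear Ψ x ∧
    Function.Injective (fderiv ℝ Ψ x) ∧
    ∀ᶠ z in 𝓝 x, α z = c.compContinuousLinearMap (fderiv ℝ Ψ z)

theorem Rectifiable.of_eventually_eq_const {α : E → E [⋀^Fin q]→L[ℝ] ℝ} {x : E}
    (c : E [⋀^Fin q]→L[ℝ] ℝ) (h : ∀ᶠ z in 𝓝 x, α z = c) : Rectifiable α x := by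
  refine ⟨id, c, .of_contDiff contDiff_id, ?_, ?_⟩
  · rw [fderiv_id]
    exact Function.injective_id
  · filter_upwards [h] with z hz
    rw [hz, fderiv_id]
    rfl

/-- With `S` a right inverse of `D = dF_x`, the map `Ψ y = y + S (F y - D y)` has derivative the
identity at `x` and satisfies `D ∘ Ψ = F`. Hence `F` pulls `c` back to what `Ψ` makes of the
constant form `c ∘ D`. -/
theorem Rectifiable.of_submersion {α : E → E [⋀^Fin q]→L[ℝ] ℝ} {x : E} {F : E → G}
    {c : G [⋀^Fin q]→L[ℝ] ℝ} (hF : SmoothNear F x) (hs : Function.Surjective (fderiv ℝ F x))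
    (h : ∀ᶠ z in 𝓝 x, α z = c.compContinuousLinearMap (fderiv ℝ F z)) : Rectifiable α x := by
  set D := fderiv ℝ F x with hD
  obtain ⟨S₀, hS₀⟩ := (D : E →ₗ[ℝ] G).exists_rightInverse_of_surjective
    (LinearMap.range_eq_top.2 hs)
  let S : G →L[ℝ] E := LinearMap.toContinuousLinearMap S₀
  have hDS : ∀ g, D (S g) = g := fun g => LinearMap.congr_fun hS₀ g
  have hder : ∀ᶠ z in 𝓝 x, HasFDerivAt (fun y => y + S (F y - D y))
      (.id ℝ E + S.comp (fderiv ℝ F z - D)) z := by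
    filter_upwards [hF.eventually_differentiableAt] with z hz
    exact (hasFDerivAt_id z).add (S.hasFDerivAt.comp z (hz.hasFDerivAt.sub D.hasFDerivAt))
  refine ⟨fun y => y + S (F y - D y), c.compContinuousLinearMap D, ?_, ?_, ?_⟩
  · exact SmoothNear.add (.of_contDiff contDiff_id)
      (.contDiff_comp S.contDiff (hF.sub (.of_contDiff D.contDiff)))
  · rw [hder.self_of_nhds.fderiv, ← hD]
    intro a b hab
    simpa using hab
  · filter_upwards [hder, h] with z hz hz'
    rw [hz', hz.fderiv]
    ext w
    simp [Function.comp_def, hDS]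

theorem Rectifiable.of_pullback {α : E → E [⋀^Fin q]→L[ℝ] ℝ} {x : E} {π : E → G}
    {β : G → G [⋀^Fin q]→L[ℝ] ℝ} (hπ : SmoothNear π x)
    (hs : Function.Surjective (fderiv ℝ π x))
    (h : ∀ᶠ z in 𝓝 x, α z = (β (π z)).compContinuousLinearMap (fderiv ℝ π z))
    (hβ : Rectifiable β (π x)) : Rectifiable α x := by
  obtain ⟨Ψ, c, hΨ, hi, hc⟩ := hβ
  have hder : ∀ᶠ z in 𝓝 x, HasFDerivAt (fun y => Ψ (π y))
      ((fderiv ℝ Ψ (π z)).comp (fderiv ℝ π z)) z := by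
    filter_upwards [hπ.eventually_differentiableAt,
      hπ.continuousAt.eventually hΨ.eventually_differentiableAt] with z h1 h2
    exact h2.hasFDerivAt.comp z h1.hasFDerivAt
  refine .of_submersion (F := fun y => Ψ (π y)) (c := c) (hΨ.comp hπ) ?_ ?_
  · rw [hder.self_of_nhds.fderiv]
    exact ((LinearMap.injective_iff_surjective (f := (fderiv ℝ Ψ (π x) : G →ₗ[ℝ] G))).1 hi).comp hs
  · filter_upwards [hder, h, hπ.continuousAt.eventually hc] with z h1 h2 h3
    rw [h2, h3, h1.fderiv]
    rfl

/-- A property holds near the image point of a submersion if it holds along the submersion. -/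
theorem eventually_of_submersion [FiniteDimensional ℝ E] {π : E → G} {x : E} (hπ : SmoothNear π x)
    (hs : Function.Surjective (fderiv ℝ π x)) {P : G → Prop} (h : ∀ᶠ z in 𝓝 x, P (π z)) :
    ∀ᶠ y in 𝓝 (π x), P y := by
  have : CompleteSpace E := FiniteDimensional.complete ℝ E
  have : CompleteSpace G := FiniteDimensional.complete ℝ G
  have hst := hπ.contDiffAt.hasStrictFDerivAt (by simp)
  rw [← hst.map_nhds_eq_of_surj (LinearMap.range_eq_top.2 hs)]
  exact h

theorem eventually_surjective_fderiv {π : E → G} {x : E} (hπ : SmoothNear π x)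
    (hs : Function.Surjective (fderiv ℝ π x)) :
    ∀ᶠ z in 𝓝 x, Function.Surjective (fderiv ℝ π z) := by
  have : CompleteSpace G := FiniteDimensional.complete ℝ G
  obtain ⟨S₀, hS₀⟩ := (fderiv ℝ π x : E →ₗ[ℝ] G).exists_rightInverse_of_surjective
    (LinearMap.range_eq_top.2 hs)
  let S : G →L[ℝ] E := LinearMap.toContinuousLinearMap S₀
  have hx : (fderiv ℝ π x).comp S = (ContinuousLinearEquiv.refl ℝ G : G ≃L[ℝ] G) := by
    ext g
    exact LinearMap.congr_fun hS₀ g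
  have hc : ContinuousAt (fun z => (fderiv ℝ π z).comp S) x :=
    hπ.fderiv.continuousAt.clm_comp continuousAt_const
  have : ∀ᶠ z in 𝓝 x, (fderiv ℝ π z).comp S ∈ Set.range ((↑) : (G ≃L[ℝ] G) → G →L[ℝ] G) :=
    hc (by
      change _ ∈ 𝓝 ((fderiv ℝ π x).comp S)
      rw [hx]
      exact ContinuousLinearEquiv.nhds _)
  filter_upwards [this] with z ⟨e, he⟩ g
  refine ⟨S (e.symm g), ?_⟩
  change ((fderiv ℝ π z).comp S) (e.symm g) = g
  rw [← he]
  simp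

/-- Rectification of a closed form of constant rank with nontrivial kernel reduces to the
corresponding problem in dimension one less. -/
theorem Rectifiable.of_reduction [FiniteDimensional ℝ E] {α : E → E [⋀^Fin (q + 1)]→L[ℝ] ℝ} {x : E}
    (hα : SmoothNear α x) (hd : ∀ᶠ z in 𝓝 x, extDeriv α z = 0)
    (hr : ∀ᶠ z in 𝓝 x, formRank (α z) = formRank (α x)) {v : E} (hv0 : v ≠ 0)
    (hv : (α x).curryLeft v = 0)
    (ih : ∀ (H : Submodule ℝ E) (β : H → H [⋀^Fin (q + 1)]→L[ℝ] ℝ) (y : H),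
      Module.finrank ℝ H + 1 = Module.finrank ℝ E → SmoothNear β y →
      (∀ᶠ h in 𝓝 y, extDeriv β h = 0) → (∀ᶠ h in 𝓝 y, formRank (β h) = formRank (α x)) →
      Rectifiable β y) : Rectifiable α x := by
  obtain ⟨X, hX, hXx, hXk⟩ := exists_annihilating_vectorField hα hr hv
  obtain ⟨H, π, β, hH, hπ, hs, hβ, hβd, h⟩ := exists_reduction hα hd hX (hXx ▸ hv0) hXk
  refine .of_pullback hπ hs h (ih H β _ hH hβ hβd (eventually_of_submersion hπ hs ?_))
  filter_upwards [h, hr, eventually_surjective_fderiv hπ hs] with z h1 h2 h3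
  rw [← h2, h1, formRank_comp _ _ h3]

end Rectifiable

/-- Composing with the inverse of the derivative at `x` normalises the map and turns the constant
form into `α x`. -/
theorem Rectifiable.exists_fderiv_eq_id {E : Type*} [NormedAddCommGroup E] [NormedSpace ℝ E]
    [FiniteDimensional ℝ E] {q : ℕ} {α : E → E [⋀^Fin q]→L[ℝ] ℝ} {x : E} (h : Rectifiable α x) :
    ∃ Ψ : E → E, SmoothNear Ψ x ∧ fderiv ℝ Ψ x = .id ℝ E ∧
      ∀ᶠ z in 𝓝 x, α z = (α x).compContinuousLinearMap (fderiv ℝ Ψ z) := by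
  obtain ⟨Ψ, c, hΨ, hi, hc⟩ := h
  let D : E ≃L[ℝ] E := (LinearEquiv.ofInjectiveEndo (fderiv ℝ Ψ x : E →ₗ[ℝ] E)
    hi).toContinuousLinearEquiv
  have hD : ∀ w, D w = fderiv ℝ Ψ x w := fun w => rfl
  have hder : ∀ᶠ z in 𝓝 x, HasFDerivAt (fun y => D.symm (Ψ y))
      ((D.symm : E →L[ℝ] E).comp (fderiv ℝ Ψ z)) z := by
    filter_upwards [hΨ.eventually_differentiableAt] with z hz
    exact (D.symm : E →L[ℝ] E).hasFDerivAt.comp z hz.hasFDerivAt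
  refine ⟨fun y => D.symm (Ψ y), .contDiff_comp D.symm.contDiff hΨ, ?_, ?_⟩
  · rw [hder.self_of_nhds.fderiv]
    ext w
    simp [← hD]
  · filter_upwards [hder, hc] with z hz hz'
    rw [hz', hc.self_of_nhds, hz.fderiv]
    ext w
    simp [Function.comp_def, ← hD]

/-! ### Closed 1-forms. -/

section OneForm

variable {E : Type*} [NormedAddCommGroup E] [NormedSpace ℝ E]

/-- A continuous linear form, viewed as an alternating `1`-form. -/
noncomputable abbrev oneForm : (E →L[ℝ] ℝ) ≃ₗᵢ[ℝ] (E [⋀^Fin 1]→L[ℝ] ℝ) :=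
  ContinuousAlternatingMap.ofSubsingletonLIE (𝕜 := ℝ) (E := E) (F := ℝ) (0 : Fin 1)

theorem oneForm_apply (a : E →L[ℝ] ℝ) (w : Fin 1 → E) : oneForm a w = a (w 0) := rfl

/-- The local Poincaré lemma for `1`-forms. -/
theorem exists_primitive {α : E → E [⋀^Fin 1]→L[ℝ] ℝ} {x : E} (hα : SmoothNear α x)
    (hd : ∀ᶠ z in 𝓝 x, extDeriv α z = 0) :
    ∃ u : E → ℝ, SmoothNear u x ∧ ∀ᶠ z in 𝓝 x, α z = oneForm (fderiv ℝ u z) := by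
  obtain ⟨r, hr, h⟩ := Metric.eventually_nhds_iff_ball.1 (hα.and hd)
  let a : E → E →L[ℝ] ℝ := fun z => oneForm.symm (α z)
  have ha : ∀ z ∈ Metric.ball x r, ContDiffAt ℝ ∞ a z := fun z hz =>
    (oneForm (E := E)).symm.contDiff.contDiffAt.comp z (h z hz).1
  have hsymm : ∀ z ∈ Metric.ball x r, ∀ v w, fderiv ℝ a z v w = fderiv ℝ a z w v := by
    intro z hz v w
    have hda := (ha z hz).differentiableAt (by simp)
    have hdα := (h z hz).1.differentiableAt (by simp)
    have h1 := congrArg (fun c => c ![v, w]) (h z hz).2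
    simp only [extDeriv_apply hdα] at h1
    replace h1 := (Fin.sum_univ_two _).symm.trans h1
    have e : ∀ v w : E, fderiv ℝ (fun y => α y fun _ => w) z v = fderiv ℝ a z v w := by
      intro v w
      change fderiv ℝ (fun y => a y w) z v = _
      rw [fderiv_clm_apply hda (differentiableAt_const w)]
      simp
    have e0 : (0 : Fin 2).removeNth ![v, w] = fun _ => w := by
      ext i; fin_cases i; rfl
    have e1 : (1 : Fin 2).removeNth ![v, w] = fun _ => v := by
      ext i; fin_cases i; rfl
    rw [e0, e1, e, e] at h1
    simp at h1
    linarith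
  obtain ⟨u, hu⟩ := (convex_ball x r).exists_forall_hasFDerivAt_of_fderiv_symmetric
    Metric.isOpen_ball (fun z hz =>
      ((ha z hz).differentiableAt (by simp)).differentiableWithinAt) hsymm
  have hball : ∀ᶠ z in 𝓝 x, z ∈ Metric.ball x r := Metric.ball_mem_nhds x hr
  refine ⟨u, ?_, ?_⟩
  · have : ContDiffOn ℝ ∞ u (Metric.ball x r) := by
      rw [contDiffOn_infty_iff_fderiv_of_isOpen Metric.isOpen_ball]
      refine ⟨fun z hz => (hu z hz).differentiableAt.differentiableWithinAt, ?_⟩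
      exact ContDiffOn.congr (fun z hz => (ha z hz).contDiffWithinAt)
        (fun z hz => (hu z hz).fderiv)
    filter_upwards [hball] with z hz
    exact this.contDiffAt (Metric.isOpen_ball.mem_nhds hz)
  · filter_upwards [hball] with z hz
    rw [(hu z hz).fderiv]
    simp [a]

/-- A primitive `u` is a submersion to `ℝ`, and `α = du` is the pullback of `dt`. -/
theorem Rectifiable.of_closed_one_form {α : E → E [⋀^Fin 1]→L[ℝ] ℝ} {x : E}
    (hα : SmoothNear α x) (hd : ∀ᶠ z in 𝓝 x, extDeriv α z = 0) (hx : α x ≠ 0) :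
    Rectifiable α x := by
  obtain ⟨u, hu, h⟩ := exists_primitive hα hd
  refine .of_submersion (c := oneForm (.id ℝ ℝ)) hu ?_ ?_
  · have h0 : fderiv ℝ u x ≠ 0 := by
      intro h0
      apply hx
      rw [h.self_of_nhds, h0, map_zero]
    obtain ⟨v, hv⟩ : ∃ v, fderiv ℝ u x v ≠ 0 := by
      by_contra! h1
      exact h0 (ContinuousLinearMap.ext h1)
    intro t
    exact ⟨(t / fderiv ℝ u x v) • v, by simp [hv]⟩
  · filter_upwards [h] with z hz
    rw [hz]
    rfl

end OneForm

/-! ### Forms of top degree. -/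

section TopForm

variable {E : Type*} [NormedAddCommGroup E] [NormedSpace ℝ E] {q : ℕ}

theorem ContinuousAlternatingMap.eq_of_apply_basis_eq (b : Module.Basis (Fin q) ℝ E)
    {c d : E [⋀^Fin q]→L[ℝ] ℝ} (h : c b = d b) : c = d := by
  apply ContinuousAlternatingMap.toAlternatingMap_injective
  rw [c.toAlternatingMap.eq_smul_basis_det b, d.toAlternatingMap.eq_smul_basis_det b]
  congr 1

theorem ContinuousAlternatingMap.apply_cons_smul_add (c : E [⋀^Fin (q + 1)]→L[ℝ] ℝ) (s : ℝ)
    (v : E) (w : Fin q → E) (t : Fin q → ℝ) :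
    c (Fin.cons (s • v) fun i => w i + t i • v) = s * c (Fin.cons v w) := by
  have h1 : ∀ u : Fin q → E, c (Fin.cons (s • v) u) = s * c (Fin.cons v u) := by
    intro u
    have := congrArg (fun d => d u) (c.curryLeft.map_smul s v)
    exact this
  rw [h1]
  congr 1
  cases q with
  | zero => congr 2; ext i; exact i.elim0
  | succ q =>
    refine (c.curryLeft v).apply_congr_of_curryLeft_sub_eq_zero fun i => ?_
    simp

/-- Nonvanishing forms of top degree are rectifiable. -/
theorem Rectifiable.of_top_form [FiniteDimensional ℝ E] {α : E → E [⋀^Fin (q + 1)]→L[ℝ] ℝ} {x : E}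
    (hα : SmoothNear α x) (hx : α x ≠ 0) (hE : Module.finrank ℝ E = q + 1) :
    Rectifiable α x := by
  let b : Module.Basis (Fin (q + 1)) ℝ E := Module.finBasisOfFinrankEq ℝ E hE
  have hb : α x b ≠ 0 := by
    intro h0
    exact hx (ContinuousAlternatingMap.eq_of_apply_basis_eq b h0)
  let f : E → ℝ := fun z => α z b / α x b
  let ev : (E [⋀^Fin (q + 1)]→L[ℝ] ℝ) →L[ℝ] ℝ := LinearMap.toContinuousLinearMap
    { toFun := fun c => c b, map_add' := fun _ _ => rfl, map_smul' := fun _ _ => rfl }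
  have hf : SmoothNear f x := SmoothNear.contDiff_comp (h := fun c => ev c / α x b)
    (ev.contDiff.div_const _) hα
  have hfx : f x = 1 := div_self hb
  have hf0 : ∀ᶠ z in 𝓝 x, f z ≠ 0 :=
    hf.continuousAt.eventually_ne (by rw [hfx]; exact one_ne_zero)
  have hinv : SmoothNear (fun z => (f z)⁻¹) x := by
    filter_upwards [hf, hf0] with z h1 h2 using h1.inv h2
  -- A time function of `f⁻¹ b₀` solves `∂u/∂b₀ = f`, where `α = f · α x`. Replacing the coordinate
  -- along `b₀` by `u` then gives a map of Jacobian determinant `f`.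
  obtain ⟨u, hu, hu1⟩ := SmoothNear.exists_time_function
    (X := fun z => (f z)⁻¹ • b 0) (hinv.smul (.of_contDiff contDiff_const))
    (by simp [hfx, b.ne_zero])
  have hub : ∀ᶠ z in 𝓝 x, fderiv ℝ u z (b 0) = f z := by
    filter_upwards [hu1, hf0] with z h1 h2
    rw [map_smul, smul_eq_mul] at h1
    field_simp at h1
    linarith
  let p : E →L[ℝ] ℝ := LinearMap.toContinuousLinearMap (b.coord 0)
  have hder : ∀ᶠ z in 𝓝 x, HasFDerivAt (fun y => y + (u y - p y) • b 0)
      (.id ℝ E + (fderiv ℝ u z - p).smulRight (b 0)) z := by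
    filter_upwards [hu.eventually_differentiableAt] with z hz
    exact (hasFDerivAt_id z).add ((hz.hasFDerivAt.sub p.hasFDerivAt).smul_const _)
  have hp0 : p (b 0) = 1 := by simp [p]
  have hp1 : ∀ i : Fin q, p (b i.succ) = 0 := fun i => by
    simp [p]
  refine ⟨fun y => y + (u y - p y) • b 0, α x, ?_, ?_, ?_⟩
  · exact SmoothNear.add (.of_contDiff contDiff_id)
      ((hu.sub (.of_contDiff p.contDiff)).smul (.of_contDiff contDiff_const))
  · rw [hder.self_of_nhds.fderiv]
    refine (injective_iff_map_eq_zero _).2 fun w hw => ?_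
    have h1 : w = -((fderiv ℝ u x - p) w) • b 0 := by
      rw [neg_smul]
      exact eq_neg_of_add_eq_zero_left hw
    have h2 := congrArg (fderiv ℝ u x) hw
    simp only [_root_.add_apply, ContinuousLinearMap.id_apply, map_add, map_zero,
      ContinuousLinearMap.smulRight_apply, map_smul, hub.self_of_nhds, hfx,
      _root_.sub_apply, smul_eq_mul, mul_one] at h2
    have h3 := congrArg p hw
    simp only [_root_.add_apply, ContinuousLinearMap.id_apply, map_add, map_zero,
      ContinuousLinearMap.smulRight_apply, map_smul, hp0,
      _root_.sub_apply, smul_eq_mul, mul_one] at h3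
    have h4 : (fderiv ℝ u x - p) w = 0 := by
      rw [_root_.sub_apply]
      linarith
    rw [h1, h4]
    simp
  · filter_upwards [hder, hub] with z hz hz'
    apply ContinuousAlternatingMap.eq_of_apply_basis_eq b
    rw [hz.fderiv]
    have e : (fun i => (ContinuousLinearMap.id ℝ E + (fderiv ℝ u z - p).smulRight (b 0)) (b i)) =
        Fin.cons (f z • b 0) fun i : Fin q => b i.succ + fderiv ℝ u z (b i.succ) • b 0 := by
      ext i
      refine Fin.cases ?_ (fun i => ?_) i
      · simp only [_root_.add_apply, ContinuousLinearMap.id_apply,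
          ContinuousLinearMap.smulRight_apply, _root_.sub_apply, hz', hp0,
          Fin.cons_zero]
        module
      · simp [hp1]
    change α z b = α x _
    change _ = α x (fun i => (ContinuousLinearMap.id ℝ E +
      (fderiv ℝ u z - p).smulRight (b 0)) (b i))
    rw [e, ContinuousAlternatingMap.apply_cons_smul_add]
    have e2 : (Fin.cons (b 0) fun i : Fin q => b i.succ : Fin (q + 1) → E) = b :=
      Fin.cons_self_tail (b : Fin (q + 1) → E)
    rw [e2]
    exact (div_mul_cancel₀ _ hb).symm

end TopForm

/-! ### Forms of codegree one. -/

section CodimensionOne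

variable {E : Type*} [NormedAddCommGroup E] [NormedSpace ℝ E] {q : ℕ}

theorem formRank_eq_zero_iff (c : E [⋀^Fin (q + 1)]→L[ℝ] ℝ) [FiniteDimensional ℝ E] :
    formRank c = 0 ↔ c = 0 := by
  rw [formRank, Submodule.finrank_eq_zero, LinearMap.range_eq_bot]
  constructor
  · intro h
    ext w
    have := congrArg (fun d => d (Fin.tail w)) (LinearMap.congr_fun h (w 0))
    change c (Fin.cons (w 0) (Fin.tail w)) = 0 at this
    rwa [Fin.cons_self_tail] at this
  · rintro rfl
    rfl

theorem ContinuousAlternatingMap.apply_comp_eq_zero (c : E [⋀^Fin q]→L[ℝ] ℝ) {g : Fin q → E}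
    (hg : c g = 0) (ρ : Fin q → Fin q) : c (g ∘ ρ) = 0 := by
  by_cases hρ : Function.Injective ρ
  · have := c.toAlternatingMap.map_perm g (Equiv.ofBijective ρ (Finite.injective_iff_bijective.1 hρ))
    change c (g ∘ ρ) = _ • c g at this
    rw [this, hg, smul_zero]
  · exact c.toAlternatingMap.map_eq_zero_of_not_injective _ fun h => hρ h.of_comp

/-- A form of codegree one has a nontrivial kernel. -/
theorem exists_curryLeft_eq_zero [FiniteDimensional ℝ E] (c : E [⋀^Fin (q + 1)]→L[ℝ] ℝ)
    (hE : Module.finrank ℝ E = q + 2) : ∃ v, v ≠ 0 ∧ c.curryLeft v = 0 := by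
  by_cases hc : c = 0
  · have : Nontrivial E := Module.nontrivial_of_finrank_pos (R := ℝ) (by omega)
    obtain ⟨v, hv⟩ := exists_ne (0 : E)
    refine ⟨v, hv, ?_⟩
    rw [hc]
    rfl
  obtain ⟨e, he⟩ : ∃ e, c e ≠ 0 := by
    by_contra! h
    exact hc (ContinuousAlternatingMap.ext h)
  have hei : LinearIndependent ℝ e := by
    by_contra h
    exact he (c.toAlternatingMap.map_linearDependent e h)
  obtain ⟨v, hv⟩ : ∃ v, v ∉ Submodule.span ℝ (Set.range e) := by
    by_contra! h
    have h1 : Submodule.span ℝ (Set.range e) = ⊤ := Submodule.eq_top_iff'.2 h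
    have h2 := finrank_span_eq_card hei
    rw [h1, finrank_top, hE, Fintype.card_fin] at h2
    omega
  -- These coefficients make `c` vanish whenever one `e i` is replaced by `v - S`. In the basis `(v
  -- - S, e)`, a value of `c(v - S, ·)` on basis vectors either repeats `v - S` or uses at most `q`
  -- of the `q + 1` vectors `e i`, hence is such a value up to rearrangement.
  let t : Fin (q + 1) → ℝ := fun i => c (Function.update e i v) / c e
  let S : E := ∑ i, t i • e i
  have hS : S ∈ Submodule.span ℝ (Set.range e) :=
    Submodule.sum_mem _ fun i _ => Submodule.smul_mem _ _ (Submodule.subset_span ⟨i, rfl⟩)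
  have hX : v - S ∉ Submodule.span ℝ (Set.range e) := fun h =>
    hv (by simpa using Submodule.add_mem _ h hS)
  have hup : ∀ i, c (Function.update e i (v - S)) = 0 := by
    intro i
    have h1 : c (Function.update e i S) = t i * c e := by
      have h2 := c.toAlternatingMap.toMultilinearMap.map_update_sum Finset.univ i
        (fun j => t j • e j) e
      change c (Function.update e i S) = ∑ j, c (Function.update e i (t j • e j)) at h2
      rw [h2, Finset.sum_eq_single i]
      · rw [c.map_update_smul, Function.update_eq_self, smul_eq_mul]
      · intro j _ hj
        rw [c.map_update_smul]
        have : c (Function.update e i (e j)) = 0 :=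
          c.map_eq_zero_of_eq _ (i := i) (j := j) (by simp [hj]) hj.symm
        rw [this, smul_zero]
      · simp
    rw [c.map_update_sub, h1, div_mul_cancel₀ _ he, sub_self]
  refine ⟨v - S, fun h => hX (h ▸ Submodule.zero_mem _), ?_⟩
  have hli : LinearIndependent ℝ (Fin.cons (v - S) e : Fin (q + 2) → E) :=
    linearIndependent_finCons.2 ⟨hei, hX⟩
  let b := basisOfLinearIndependentOfCardEqFinrank hli (by simp [hE])
  have hb : ∀ j, b j = (Fin.cons (v - S) e : Fin (q + 2) → E) j := fun j => by simp [b]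
  apply ContinuousAlternatingMap.toAlternatingMap_injective
  refine Module.Basis.ext_alternating b fun σ _ => ?_
  change c (Fin.cons (v - S) fun k => b (σ k)) = 0
  by_cases h0 : ∃ k, σ k = 0
  · obtain ⟨k, hk⟩ := h0
    refine c.map_eq_zero_of_eq _ (i := 0) (j := k.succ) ?_ (Fin.succ_ne_zero k).symm
    simp [hk, hb]
  · push Not at h0
    let τ : Fin q → Fin (q + 1) := fun k => (σ k).pred (h0 k)
    obtain ⟨i, hi⟩ : ∃ i, ∀ k, τ k ≠ i := by
      by_contra! h
      have := Fintype.card_le_of_surjective τ h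
      simp at this
    convert c.apply_comp_eq_zero (hup i) (Fin.cons i τ) using 2
    ext k
    refine Fin.cases (by simp) (fun k => ?_) k
    have h1 : b (σ k) = e (τ k) := by
      rw [hb, ← Fin.succ_pred (σ k) (h0 k), Fin.cons_succ]
    simp [h1, hi k]

/-- Closed forms of codegree one and locally constant rank are rectifiable. -/
theorem Rectifiable.of_codegree_one [FiniteDimensional ℝ E] {α : E → E [⋀^Fin (q + 1)]→L[ℝ] ℝ}
    {x : E} (hα : SmoothNear α x) (hd : ∀ᶠ z in 𝓝 x, extDeriv α z = 0)
    (hr : ∀ᶠ z in 𝓝 x, formRank (α z) = formRank (α x)) (hx : α x ≠ 0)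
    (hE : Module.finrank ℝ E = q + 2) : Rectifiable α x := by
  obtain ⟨v, hv0, hv⟩ := exists_curryLeft_eq_zero (α x) hE
  refine .of_reduction hα hd hr hv0 hv fun H β y hH hβ _ hβr => .of_top_form hβ ?_ (by omega)
  rw [Ne, ← formRank_eq_zero_iff] at hx ⊢
  rwa [hβr.self_of_nhds]

end CodimensionOne

/-! ### Linear algebra of 2-forms. -/

section TwoForm

/-- The wedge product of two linear forms. -/
noncomputable def wedge {E : Type*} [NormedAddCommGroup E] [NormedSpace ℝ E] (a b : E →L[ℝ] ℝ) :
    E [⋀^Fin 2]→L[ℝ] ℝ :=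
  ContinuousAlternatingMap.alternatizeUncurryFin (a.smulRight (oneForm b))

variable {E : Type*} [NormedAddCommGroup E] [NormedSpace ℝ E]

theorem wedge_apply (a b : E →L[ℝ] ℝ) (w : Fin 2 → E) :
    wedge a b w = a (w 0) * b (w 1) - a (w 1) * b (w 0) := by
  rw [wedge, ContinuousAlternatingMap.alternatizeUncurryFin_apply]
  refine (Fin.sum_univ_two _).trans ?_
  have e0 : (0 : Fin 2).removeNth w = fun _ => w 1 := by
    ext i; fin_cases i; rfl
  have e1 : (1 : Fin 2).removeNth w = fun _ => w 0 := by
    ext i; fin_cases i; rfl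
  rw [e0, e1]
  simp [sub_eq_add_neg]

theorem curryLeft_wedge (a b : E →L[ℝ] ℝ) (v : E) :
    (wedge a b).curryLeft v = oneForm (a v • b - b v • a) := by
  ext w
  rw [ContinuousAlternatingMap.curryLeft_apply_apply, wedge_apply, oneForm_apply]
  change a v * b (w 0) - a (w 0) * b v = a v * b (w 0) - b v * a (w 0)
  ring

theorem curryLeft_sub (c d : E [⋀^Fin 2]→L[ℝ] ℝ) (v : E) :
    (c - d).curryLeft v = c.curryLeft v - d.curryLeft v := rfl

theorem curryLeft_apply_swap (c : E [⋀^Fin 2]→L[ℝ] ℝ) (v w : E) :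
    c.curryLeft v (fun _ => w) = - c.curryLeft w fun _ => v := by
  have e : ∀ v w : E, c.curryLeft v (fun _ => w) = c ![v, w] := by
    intro v w
    rw [ContinuousAlternatingMap.curryLeft_apply_apply]
    congr 1
    ext i
    fin_cases i <;> rfl
  rw [e, e]
  have := c.toAlternatingMap.map_swap ![w, v] (i := 0) (j := 1) (by simp)
  have e2 : (![w, v] : Fin 2 → E) ∘ Equiv.swap 0 1 = ![v, w] := by
    ext i
    fin_cases i <;> simp
  rw [e2] at this
  exact this

variable [FiniteDimensional ℝ E]

theorem exists_curryLeft_equiv (c : E [⋀^Fin 2]→L[ℝ] ℝ) (hc : ∀ v, c.curryLeft v = 0 → v = 0) :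
    ∃ L : E ≃L[ℝ] E [⋀^Fin 1]→L[ℝ] ℝ, (c.curryLeft : E →L[ℝ] E [⋀^Fin 1]→L[ℝ] ℝ) = L := by
  have hfr : Module.finrank ℝ E = Module.finrank ℝ (E [⋀^Fin 1]→L[ℝ] ℝ) := by
    rw [← (oneForm (E := E)).toLinearEquiv.finrank_eq,
      (LinearMap.toContinuousLinearMap (𝕜 := ℝ) (E := E) (F' := ℝ)).symm.finrank_eq]
    exact (Subspace.dual_finrank_eq (K := ℝ) (V := E)).symm
  have hinj : Function.Injective (c.curryLeft : E →ₗ[ℝ] E [⋀^Fin 1]→L[ℝ] ℝ) :=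
    (injective_iff_map_eq_zero _).2 hc
  refine ⟨(LinearEquiv.ofBijective _ ⟨hinj,
    (LinearMap.injective_iff_surjective_of_finrank_eq_finrank hfr).1 hinj⟩).toContinuousLinearEquiv,
    ?_⟩
  ext v : 1
  rfl

/-- Splitting off a hyperbolic plane from a symplectic form. -/
theorem exists_symplectic_partner {c : E [⋀^Fin 2]→L[ℝ] ℝ} (hc : ∀ v, c.curryLeft v = 0 → v = 0)
    {a b : E →L[ℝ] ℝ} {X : E} (hX : c.curryLeft X = oneForm b) (ha : a X = 1) :
    ∃ Y, b X = 0 ∧ a Y = 0 ∧ b Y = -1 ∧ (c - wedge a b).curryLeft X = 0 ∧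
      (c - wedge a b).curryLeft Y = 0 ∧ formRank (c - wedge a b) + 2 = Module.finrank ℝ E := by
  obtain ⟨L, hL⟩ := exists_curryLeft_equiv c hc
  obtain ⟨Y, hY⟩ : ∃ Y, c.curryLeft Y = oneForm a := ⟨L.symm (oneForm a), by simp [hL]⟩
  have ev : ∀ {v : E} {l : E →L[ℝ] ℝ}, c.curryLeft v = oneForm l →
      ∀ w, l w = c.curryLeft v fun _ => w := by
    intro v l h w
    rw [h]
    rfl
  have hbX : b X = 0 := by
    have h1 := ev hX X
    have h2 := curryLeft_apply_swap c X X
    linarith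
  have haY : a Y = 0 := by
    have h1 := ev hY Y
    have h2 := curryLeft_apply_swap c Y Y
    linarith
  have hbY : b Y = -1 := by
    rw [ev hX Y, curryLeft_apply_swap, ← ev hY X, ha]
  -- By nondegeneracy of `c`, the kernel of `c - a ∧ b` consists of the `w` with `w = a w • X - b w
  -- • Y`, which is the span of `X` and `Y`.
  have key : ∀ w, (c - wedge a b).curryLeft w = c.curryLeft (w - (a w • X - b w • Y)) := by
    intro w
    rw [curryLeft_sub, curryLeft_wedge]
    simp only [map_sub, map_smul, hX, hY]
  have hKX : (c - wedge a b).curryLeft X = 0 := by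
    rw [key, ha, hbX]
    simp
  have hKY : (c - wedge a b).curryLeft Y = 0 := by
    rw [key, haY, hbY]
    simp
  refine ⟨Y, hbX, haY, hbY, hKX, hKY, ?_⟩
  rw [← formRank_add_finrank_ker (c - wedge a b)]
  congr 1
  have hli : LinearIndependent ℝ ![X, Y] := by
    rw [LinearIndependent.pair_iff]
    intro s t hst
    have h1 := congrArg a hst
    have h2 := congrArg b hst
    simp only [map_add, map_smul, ha, haY, hbX, hbY, map_zero, smul_eq_mul] at h1 h2
    constructor <;> linarith
  have hspan : LinearMap.ker ((c - wedge a b).curryLeft : E →ₗ[ℝ] E [⋀^Fin 1]→L[ℝ] ℝ) =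
      Submodule.span ℝ (Set.range ![X, Y]) := by
    apply le_antisymm
    · intro w hw
      have h1 : (c - wedge a b).curryLeft w = 0 := hw
      rw [key] at h1
      have h2 := sub_eq_zero.1 (hc _ h1)
      rw [h2]
      exact Submodule.sub_mem _ (Submodule.smul_mem _ _ (Submodule.subset_span ⟨0, rfl⟩))
        (Submodule.smul_mem _ _ (Submodule.subset_span ⟨1, rfl⟩))
    · rw [Submodule.span_le]
      rintro _ ⟨i, rfl⟩
      fin_cases i
      · exact hKX
      · exact hKY
  rw [hspan, finrank_span_eq_card hli]
  rfl

end TwoForm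

/-! ### Darboux's theorem. -/

section Darboux

universe u

theorem wedge_fderiv_eq_pullback {E : Type*} [NormedAddCommGroup E] [NormedSpace ℝ E] {f g : E → ℝ}
    {x : E} (hf : DifferentiableAt ℝ f x) (hg : DifferentiableAt ℝ g x) :
    wedge (fderiv ℝ f x) (fderiv ℝ g x) =
      (wedge (.fst ℝ ℝ ℝ) (.snd ℝ ℝ ℝ)).compContinuousLinearMap
        (fderiv ℝ (fun z => (f z, g z)) x) := by
  ext w
  rw [(hf.hasFDerivAt.prodMk hg.hasFDerivAt).fderiv,
    ContinuousAlternatingMap.compContinuousLinearMap_apply, wedge_apply, wedge_apply]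
  rfl

theorem SmoothNear.wedge_fderiv {E : Type*} [NormedAddCommGroup E] [NormedSpace ℝ E]
    [FiniteDimensional ℝ E] {f g : E → ℝ} {x : E} (hf : SmoothNear f x) (hg : SmoothNear g x) :
    SmoothNear (fun z => wedge (_root_.fderiv ℝ f z) (_root_.fderiv ℝ g z)) x ∧
      ∀ᶠ z in 𝓝 x,
        extDeriv (fun z => wedge (_root_.fderiv ℝ f z) (_root_.fderiv ℝ g z)) z = 0 := by
  have h : (fun z => wedge (_root_.fderiv ℝ f z) (_root_.fderiv ℝ g z)) =ᶠ[𝓝 x] fun z =>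
      (wedge (.fst ℝ ℝ ℝ) (.snd ℝ ℝ ℝ)).compContinuousLinearMap
        (_root_.fderiv ℝ (fun z => (f z, g z)) z) := by
    filter_upwards [hf.eventually_differentiableAt, hg.eventually_differentiableAt] with z h1 h2
    exact wedge_fderiv_eq_pullback h1 h2
  have hc : SmoothNear (fun _ : ℝ × ℝ => wedge (.fst ℝ ℝ ℝ) (.snd ℝ ℝ ℝ)) (f x, g x) :=
    .of_contDiff contDiff_const
  refine ⟨(hc.pullback (f := fun z => (f z, g z)) (hf.prodMk hg)).congr h, ?_⟩
  have hd := eventually_extDeriv_pullback (f := fun z => (f z, g z)) hc (hf.prodMk hg)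
    (Eventually.of_forall fun y => by
      simp only [extDeriv, fderiv_fun_const, Pi.zero_apply]
      exact (ContinuousAlternatingMap.alternatizeUncurryFinCLM ℝ (ℝ × ℝ) ℝ).map_zero)
  filter_upwards [hd, eventually_eventually_nhds.2 h] with z h1 h2
  rw [EventuallyEq.extDeriv_eq h2, h1]

/-- Darboux's theorem for closed `2`-forms of constant rank. -/
theorem Rectifiable.of_closed_two_form (n : ℕ) : ∀ (E : Type u) [NormedAddCommGroup E]
    [NormedSpace ℝ E] [FiniteDimensional ℝ E] (α : E → E [⋀^Fin 2]→L[ℝ] ℝ) (x : E),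
    Module.finrank ℝ E = n → SmoothNear α x → (∀ᶠ z in 𝓝 x, extDeriv α z = 0) →
    (∀ᶠ z in 𝓝 x, formRank (α z) = formRank (α x)) → Rectifiable α x := by
  induction n with
  | zero =>
    intro E _ _ _ α x hE _ _ _
    have : Subsingleton E := Module.finrank_zero_iff.1 hE
    exact .of_eventually_eq_const (α x) (Eventually.of_forall fun z => by
      rw [Subsingleton.elim z x])
  | succ n ih =>
    intro E _ _ _ α x hE hα hd hr
    -- Stated for an arbitrary form, as it also serves for `α'` in the nondegenerate case.
    have degenerate : ∀ (α : E → E [⋀^Fin 2]→L[ℝ] ℝ), SmoothNear α x →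
        (∀ᶠ z in 𝓝 x, extDeriv α z = 0) → (∀ᶠ z in 𝓝 x, formRank (α z) = formRank (α x)) →
        ∀ v, v ≠ 0 → (α x).curryLeft v = 0 → Rectifiable α x := by
      intro α hα hd hr v hv0 hv
      refine .of_reduction hα hd hr hv0 hv fun H β y hH hβ hβd hβr => ?_
      refine ih H β y (by omega) hβ hβd ?_
      rwa [hβr.self_of_nhds]
    by_cases hker : ∃ v, v ≠ 0 ∧ (α x).curryLeft v = 0
    · obtain ⟨v, hv0, hv⟩ := hker
      exact degenerate α hα hd hr v hv0 hv
    have hnd : ∀ v, (α x).curryLeft v = 0 → v = 0 := by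
      intro v hv
      by_contra hv0
      exact hker ⟨v, hv0, hv⟩
    have : Nontrivial E := Module.nontrivial_of_finrank_pos (R := ℝ) (by omega)
    have : CompleteSpace E := FiniteDimensional.complete ℝ E
    obtain ⟨v₀, hv₀⟩ := exists_ne (0 : E)
    obtain ⟨b, hb⟩ := exists_dual_eq_one hv₀
    obtain ⟨L, hL⟩ := exists_curryLeft_equiv (α x) hnd
    have hA : SmoothNear (fun z => (α z).curryLeft) x :=
      SmoothNear.contDiff_comp (h := fun c : E [⋀^Fin 2]→L[ℝ] ℝ => c.curryLeft)
        contDiff_curryLeft hα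
    -- The Hamiltonian field of the linear function `b`. A time function `u` of `X` is conjugate to
    -- `b`.
    let X : E → E := fun z => (α z).curryLeft.inverse (oneForm b)
    have hX : SmoothNear X x := (hA.inverse L hL).clm_apply (.of_contDiff contDiff_const)
    have hLn : ∀ᶠ z in 𝓝 x, (α z).curryLeft ∈
        Set.range ((↑) : (E ≃L[ℝ] E [⋀^Fin 1]→L[ℝ] ℝ) → E →L[ℝ] E [⋀^Fin 1]→L[ℝ] ℝ) :=
      hA.continuousAt (by
        rw [hL]
        exact L.nhds)
    have hXb : ∀ᶠ z in 𝓝 x, (α z).curryLeft (X z) = oneForm b := by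
      filter_upwards [hLn] with z ⟨e, he⟩
      simp only [X, ← he, ContinuousLinearMap.inverse_equiv]
      simp
    have hndz : ∀ᶠ z in 𝓝 x, ∀ v, (α z).curryLeft v = 0 → v = 0 := by
      filter_upwards [hLn] with z ⟨e, he⟩ v hv
      rw [← he] at hv
      exact e.map_eq_zero_iff.1 hv
    have hX0 : X x ≠ 0 := by
      intro h0
      have h1 := hXb.self_of_nhds
      rw [h0, map_zero] at h1
      have h2 : b = 0 := (oneForm (E := E)).injective (by rw [← h1, map_zero])
      simp [h2] at hb
    obtain ⟨u, hu, huX⟩ := hX.exists_time_function hX0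
    have hbs : SmoothNear b x := .of_contDiff b.contDiff
    obtain ⟨hws, hwd⟩ := hu.wedge_fderiv hbs
    simp only [ContinuousLinearMap.fderiv] at hws hwd
    let α' : E → E [⋀^Fin 2]→L[ℝ] ℝ := fun z => α z - wedge (fderiv ℝ u z) b
    have hα' : SmoothNear α' x := hα.sub hws
    have hd' : ∀ᶠ z in 𝓝 x, extDeriv α' z = 0 := by
      filter_upwards [hd, hwd, hα.eventually_differentiableAt, hws.eventually_differentiableAt]
        with z h1 h2 h3 h4
      have : α' = α + (-1 : ℝ) • fun z => wedge (fderiv ℝ u z) b := by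
        ext1 z
        ext w
        simp [α', sub_eq_add_neg]
      rw [this, extDeriv_add h3 (h4.const_smul _), extDeriv_smul, h1, h2]
      simp
    have hr2 : ∀ᶠ z in 𝓝 x, formRank (α' z) + 2 = Module.finrank ℝ E := by
      filter_upwards [hndz, hXb, huX] with z h1 h2 h3
      obtain ⟨Y, -, -, -, -, -, h⟩ := exists_symplectic_partner h1 h2 h3
      exact h
    have hr' : ∀ᶠ z in 𝓝 x, formRank (α' z) = formRank (α' x) := by
      filter_upwards [hr2] with z hz
      have := hr2.self_of_nhds
      omega
    obtain ⟨Y, hbX, haY, hbY, hKX, hKY, -⟩ :=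
      exists_symplectic_partner hnd hXb.self_of_nhds huX.self_of_nhds
    set a := fderiv ℝ u x with ha
    have haX : a (X x) = 1 := huX.self_of_nhds
    obtain ⟨Ψ, hΨ, hΨx, hΨα⟩ := (degenerate α' hα' hd' hr' _ hX0 hKX).exists_fderiv_eq_id
    have hder : ∀ᶠ z in 𝓝 x, HasFDerivAt
        (fun y => Ψ y + (u y - a (Ψ y)) • X x + (b (Ψ y) - b y) • Y)
        (fderiv ℝ Ψ z + (fderiv ℝ u z - a.comp (fderiv ℝ Ψ z)).smulRight (X x) +
          (b.comp (fderiv ℝ Ψ z) - b).smulRight Y) z := by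
      filter_upwards [hΨ.eventually_differentiableAt, hu.eventually_differentiableAt]
        with z h1 h2
      exact (h1.hasFDerivAt.add ((h2.hasFDerivAt.sub
        (a.hasFDerivAt.comp z h1.hasFDerivAt)).smul_const (X x))).add
        (((b.hasFDerivAt.comp z h1.hasFDerivAt).sub b.hasFDerivAt).smul_const Y)
    -- The corrections lie in the kernel of `α' x`, so the pullback of `α' x` is still `α'`. By `a X
    -- = 1`, `a Y = 0`, `b X = 0` and `b Y = -1`, the new map has `a`-component `u` and
    -- `b`-component `b`, so it pulls `a ∧ b` back to `du ∧ b`.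
    refine ⟨fun y => Ψ y + (u y - a (Ψ y)) • X x + (b (Ψ y) - b y) • Y, α x, ?_, ?_, ?_⟩
    · have hc : ∀ v : E, SmoothNear (fun _ : E => v) x := fun v => .of_contDiff contDiff_const
      exact (hΨ.add ((hu.sub (.contDiff_comp a.contDiff hΨ)).smul (hc _))).add
        (((SmoothNear.contDiff_comp b.contDiff hΨ).sub hbs).smul (hc _))
    · rw [hder.self_of_nhds.fderiv, hΨx]
      have : ContinuousLinearMap.id ℝ E +
          (fderiv ℝ u x - a.comp (ContinuousLinearMap.id ℝ E)).smulRight (X x) +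
          (b.comp (ContinuousLinearMap.id ℝ E) - b).smulRight Y = .id ℝ E := by
        ext w
        simp [← ha]
      rw [this]
      exact Function.injective_id
    · filter_upwards [hder, hΨα] with z hz hz'
      rw [hz.fderiv]
      set D := fderiv ℝ Ψ z + (fderiv ℝ u z - a.comp (fderiv ℝ Ψ z)).smulRight (X x) +
          (b.comp (fderiv ℝ Ψ z) - b).smulRight Y with hD
      have hDw : ∀ w, D w = fderiv ℝ Ψ z w + (fderiv ℝ u z w - a (fderiv ℝ Ψ z w)) • X x +
          (b (fderiv ℝ Ψ z w) - b w) • Y := fun w => rfl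
      have hDa : ∀ w, a (D w) = fderiv ℝ u z w := by
        intro w
        rw [hDw]
        simp only [map_add, map_smul, haX, haY, smul_eq_mul]
        ring
      have hDb : ∀ w, b (D w) = b w := by
        intro w
        rw [hDw]
        simp only [map_add, map_smul, hbX, hbY, smul_eq_mul]
        ring
      have e1 : (α' x).compContinuousLinearMap D = α' z := by
        rw [hz']
        ext w
        refine (α' x).apply_congr_of_curryLeft_sub_eq_zero
          (w := D ∘ w) (w' := fderiv ℝ Ψ z ∘ w) fun i => ?_
        have : D (w i) - fderiv ℝ Ψ z (w i) =
            (fderiv ℝ u z (w i) - a (fderiv ℝ Ψ z (w i))) • X x +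
              (b (fderiv ℝ Ψ z (w i)) - b (w i)) • Y := by
          rw [hDw]
          abel
        simp only [Function.comp_apply, this, map_add, map_smul]
        have hKX' : (α' x).curryLeft (X x) = 0 := hKX
        have hKY' : (α' x).curryLeft Y = 0 := hKY
        rw [hKX', hKY', smul_zero, smul_zero, add_zero]
      have e2 : α z = α' z + wedge (fderiv ℝ u z) b := by simp [α']
      have e3 : α x = α' x + wedge a b := by simp [α', ha]
      rw [e2, e3, ← e1]
      ext w
      simp [wedge_apply, hDa, hDb]

end Darboux

/-! ### From local expressions to charts of the manifold. -/

section Manifold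

theorem OpenPartialHomeomorph.mem_contDiffGroupoid {n : ℕ}
    (e : OpenPartialHomeomorph (EuclideanSpace ℝ (Fin n)) (EuclideanSpace ℝ (Fin n)))
    (h : ContDiffOn ℝ ∞ e e.source) (h' : ContDiffOn ℝ ∞ e.symm e.target) :
    e ∈ contDiffGroupoid ∞ (𝓡 n) := by
  refine mem_groupoid_of_pregroupoid.2 ⟨?_, ?_⟩
  · simpa [contDiffPregroupoid] using h
  · simpa [contDiffPregroupoid] using h'

theorem OpenPartialHomeomorph.trans_mem_maximalAtlas {n : ℕ} {M : Type*} [TopologicalSpace M]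
    [ChartedSpace (EuclideanSpace ℝ (Fin n)) M]
    {φ : OpenPartialHomeomorph M (EuclideanSpace ℝ (Fin n))}
    (hφ : φ ∈ IsManifold.maximalAtlas (𝓡 n) ∞ M)
    {e : OpenPartialHomeomorph (EuclideanSpace ℝ (Fin n)) (EuclideanSpace ℝ (Fin n))}
    (he : e ∈ contDiffGroupoid ∞ (𝓡 n)) :
    φ.trans e ∈ IsManifold.maximalAtlas (𝓡 n) ∞ M := by
  intro φ' hφ'
  obtain ⟨h1, h2⟩ := hφ φ' hφ'
  constructor
  · rw [OpenPartialHomeomorph.trans_symm_eq_symm_trans_symm, OpenPartialHomeomorph.trans_assoc]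
    exact (contDiffGroupoid ∞ (𝓡 n)).trans ((contDiffGroupoid ∞ (𝓡 n)).symm he) h1
  · rw [← OpenPartialHomeomorph.trans_assoc]
    exact (contDiffGroupoid ∞ (𝓡 n)).trans h2 he

namespace FormField

variable {n q : ℕ} {M : Type*} [TopologicalSpace M] [ChartedSpace (EuclideanSpace ℝ (Fin n)) M]
  [IsManifold (𝓡 n) ∞ M]

/-- The isomorphism between tangent spaces is transported to `ℝⁿ` by the derivatives of the inverse
chart at `y` and `z`. -/
theorem exists_inCoordinates_eq_comp {ζ : FormField n q M} (hζ : ζ.IsAlgebraicallyConstant)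
    (x : M) {y z : EuclideanSpace ℝ (Fin n)}
    (hy : y ∈ (chartAt (EuclideanSpace ℝ (Fin n)) x).target)
    (hz : z ∈ (chartAt (EuclideanSpace ℝ (Fin n)) x).target) :
    ∃ L : EuclideanSpace ℝ (Fin n) ≃L[ℝ] EuclideanSpace ℝ (Fin n),
      ζ.inCoordinates (chartAt _ x) z = (ζ.inCoordinates (chartAt _ x) y).compContinuousLinearMap
        (L : EuclideanSpace ℝ (Fin n) →L[ℝ] EuclideanSpace ℝ (Fin n)) := by
  set φ := chartAt (EuclideanSpace ℝ (Fin n)) x with hφ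
  have : IsManifold (𝓡 n) 1 M := IsManifold.of_le (n := ∞) (by simp)
  have hM : φ.MDifferentiable (𝓡 n) (𝓡 n) :=
    mdifferentiable_of_mem_atlas (chart_mem_atlas _ x)
  let A : ∀ w ∈ φ.target, EuclideanSpace ℝ (Fin n) ≃L[ℝ] EuclideanSpace ℝ (Fin n) :=
    fun w hw => hM.symm.mfderiv (x := w) hw
  have hA : ∀ w (hw : w ∈ φ.target) v, A w hw v = mfderiv (𝓡 n) (𝓡 n) φ.symm w v :=
    fun w hw v => rfl
  obtain ⟨L, hL⟩ := hζ (φ.symm y) (φ.symm z)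
  let L' : EuclideanSpace ℝ (Fin n) ≃L[ℝ] EuclideanSpace ℝ (Fin n) := L
  refine ⟨(A z hz).trans (L'.symm.trans (A y hy).symm), ?_⟩
  ext w
  have h1 : ζ.inCoordinates φ z w = ζ (φ.symm y) fun i => L'.symm (A z hz (w i)) := by
    rw [inCoordinates, ← hL]
    rfl
  rw [h1]
  change _ = ζ (φ.symm y) fun i => A y hy ((A y hy).symm (L'.symm (A z hz (w i))))
  simp only [ContinuousLinearEquiv.apply_symm_apply]

/-- Rectifying coordinates of the local expression are coordinates with constant components. -/
theorem exists_chart_of_rectifiable {ζ : FormField n q M} {x : M}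
    (h : Rectifiable (ζ.inCoordinates (chartAt _ x)) (chartAt (EuclideanSpace ℝ (Fin n)) x x)) :
    ∃ φ ∈ IsManifold.maximalAtlas (𝓡 n) ∞ M, x ∈ φ.source ∧
      ∀ i : Fin q → Fin n, ∃ c : ℝ, ∀ y ∈ φ.target, ζ.component φ i y = c := by
  set φ := chartAt (EuclideanSpace ℝ (Fin n)) x with hφ
  have : IsManifold (𝓡 n) 1 M := IsManifold.of_le (n := ∞) (by simp)
  have hM : φ.MDifferentiable (𝓡 n) (𝓡 n) :=
    mdifferentiable_of_mem_atlas (chart_mem_atlas _ x)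
  obtain ⟨Ψ, hΨ, hΨx, hα⟩ := h.exists_fderiv_eq_id
  set α := ζ.inCoordinates φ with hαdef
  obtain ⟨e₀, hxe₀, he₀, h1, h2⟩ := hΨ.exists_openPartialHomeomorph (.refl ℝ _)
    (by
      have := hΨ.differentiableAt.hasFDerivAt
      rwa [hΨx] at this)
  have heΨ : (e₀ : EuclideanSpace ℝ (Fin n) → EuclideanSpace ℝ (Fin n)) = Ψ := funext he₀
  -- Restriction to `U` makes the pullback identity, and so constancy of the components, hold on the
  -- whole new chart.
  obtain ⟨U, hU, hUo, hxU⟩ := eventually_nhds_iff.1 hα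
  let e := e₀.restrOpen U hUo
  have hes : ∀ w ∈ e.target, ContDiffAt ℝ ∞ e.symm w := fun w hw => h2 w hw.1
  have he : ∀ z ∈ e.source, ContDiffAt ℝ ∞ e z := fun z hz => by
    change ContDiffAt ℝ ∞ e₀ z
    rw [heΨ]
    exact h1 z hz.1
  refine ⟨φ.trans e, OpenPartialHomeomorph.trans_mem_maximalAtlas
    (IsManifold.chart_mem_maximalAtlas x) (e.mem_contDiffGroupoid
      (fun z hz => (he z hz).contDiffWithinAt) (fun w hw => (hes w hw).contDiffWithinAt)),
    ?_, fun i => ⟨α (φ x) fun k => EuclideanSpace.single (i k) 1, fun y hy => ?_⟩⟩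
  · rw [OpenPartialHomeomorph.trans_source]
    exact ⟨mem_chart_source _ x, hxe₀, hxU⟩
  · rw [OpenPartialHomeomorph.trans_target] at hy
    obtain ⟨hye, hyφ⟩ := hy
    have hyφ' : e.symm y ∈ φ.target := hyφ
    have hd : MDifferentiableAt (𝓡 n) (𝓡 n) φ.symm (e.symm y) := hM.mdifferentiableAt_symm hyφ'
    have hes' := (hes y hye).differentiableAt (by simp)
    have hsource := e.map_target hye
    have hchain : mfderiv (𝓡 n) (𝓡 n) (φ.trans e).symm y =
        (mfderiv (𝓡 n) (𝓡 n) φ.symm (e.symm y)).comp (fderiv ℝ e.symm y) := by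
      have := mfderiv_comp (I := 𝓡 n) (I' := 𝓡 n) (I'' := 𝓡 n) y (g := φ.symm) (f := e.symm) hd
        hes'.mdifferentiableAt
      rw [mfderiv_eq_fderiv] at this
      exact this
    have hI := (e.fderiv_symm_comp hye ((he _ hsource).differentiableAt (by simp)) hes').2
    have heΨ' : fderiv ℝ e (e.symm y) = fderiv ℝ Ψ (e.symm y) := by
      rw [← heΨ]
      rfl
    have hαy := hU (e.symm y) hsource.2
    have hw : ∀ v, fderiv ℝ Ψ (e.symm y) (fderiv ℝ e.symm y v) = v := fun v => by
      rw [← heΨ']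
      exact congrArg (fun B : EuclideanSpace ℝ (Fin n) →L[ℝ] EuclideanSpace ℝ (Fin n) => B v) hI
    have h3 : ζ.component (φ.trans e) i y =
        α (e.symm y) fun k => fderiv ℝ e.symm y (EuclideanSpace.single (i k) 1) := by
      rw [component, inCoordinates, hchain]
      rfl
    rw [h3, hαy]
    change α (φ x) (fun k => fderiv ℝ Ψ (e.symm y) (fderiv ℝ e.symm y _)) = _
    simp only [hw]

end FormField

end Manifold

theorem Rectifiable.of_locally_equivalent {n q : ℕ} (hq : q = 0 ∨ q = 1 ∨ q = 2 ∨ q + 1 = n ∨ q = n)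
    {E : Type*} [NormedAddCommGroup E] [NormedSpace ℝ E] [FiniteDimensional ℝ E]
    (hE : Module.finrank ℝ E = n) {α : E → E [⋀^Fin q]→L[ℝ] ℝ} {x : E} (hα : SmoothNear α x)
    (hd : ∀ᶠ z in 𝓝 x, extDeriv α z = 0)
    (hc : ∀ᶠ z in 𝓝 x, ∃ L : E ≃L[ℝ] E, α z = (α x).compContinuousLinearMap (L : E →L[ℝ] E)) :
    Rectifiable α x := by
  by_cases hx : α x = 0
  · refine .of_eventually_eq_const 0 ?_
    filter_upwards [hc] with z ⟨L, hL⟩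
    rw [hL, hx]
    rfl
  cases q with
  | zero =>
    refine .of_eventually_eq_const (α x) ?_
    filter_upwards [hc] with z ⟨L, hL⟩
    rw [hL]
    ext w
    rw [ContinuousAlternatingMap.compContinuousLinearMap_apply]
    congr 1
    exact Subsingleton.elim _ _
  | succ q =>
    have hr : ∀ᶠ z in 𝓝 x, formRank (α z) = formRank (α x) := by
      filter_upwards [hc] with z ⟨L, hL⟩
      rw [hL, formRank_comp _ _ L.surjective]
    rcases hq with hq | hq | hq | hq | hq
    · omega
    · obtain rfl : q = 0 := by omega
      exact .of_closed_one_form hα hd hx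
    · obtain rfl : q = 1 := by omega
      exact .of_closed_two_form n E α x hE hα hd hr
    · exact .of_codegree_one hα hd hr hx (by omega)
    · exact .of_top_form hα hx (by omega)

theorem propositionD (n q : ℕ) (hq : q = 0 ∨ q = 1 ∨ q = 2 ∨ q + 1 = n ∨ q = n)
    (M : Type*) [TopologicalSpace M] [ChartedSpace (EuclideanSpace ℝ (Fin n)) M]
    [IsManifold (𝓡 n) ∞ M]
    (ζ : FormField n q M) (hsmooth : ζ.IsSmooth) (hconst : ζ.IsAlgebraicallyConstant)
    (hclosed : ζ.IsClosed) :
    ζ.IsLocallyConstant := by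
  intro x
  have hφ := IsManifold.chart_mem_maximalAtlas (I := 𝓡 n) (n := ∞) x
  have hx := mem_chart_target (EuclideanSpace ℝ (Fin n)) x
  have hev := (chartAt (EuclideanSpace ℝ (Fin n)) x).open_target.mem_nhds hx
  refine FormField.exists_chart_of_rectifiable
    (Rectifiable.of_locally_equivalent hq (by simp) ?_ ?_ ?_)
  · filter_upwards [hev] with z hz
    exact (hsmooth _ hφ).contDiffAt ((chartAt _ x).open_target.mem_nhds hz)
  · filter_upwards [hev] with z hz using hclosed _ hφ z hz
  · filter_upwards [hev] with z hz
    exact FormField.exists_inCoordinates_eq_comp hconst x hx hz
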